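/- For an immersed smooth curve $\gamma$ in $\mathbb{R}^3$ with parameter $x\in\mathbb{R}$, let $e_0=\gamma_x/\|\gamma_x\|$ be the unit tangent, $\nabla_{e_0}\xi=\xi_x/\|\gamma_x\|$ for a vector field $\xi$ along $\gamma$, $H(\gamma)=\nabla_{e_0}e_0$ the mean curvature vector, and $\nabla^\perp_{e_0}\xi=(\nabla_{e_0}\xi)^\perp$ the component of $\nabla_{e_0}\xi$ normal to $\gamma$. Consider the curve flows $$\gamma_t=-\tfrac14\nabla^\perp_{e_0}H(\gamma)\ \ \text{(geometric Airy flow)},\qquad \gamma_t=X(\gamma):=-\tfrac18\|H(\gamma)\|^2e_0-\tfrac14\nabla^\perp_{e_0}H(\gamma)\ \ \text{(normalized geometric Airy flow)},$$ $$\gamma_t=Y(\gamma):=\tfrac12\,e_0\times H(\gamma)\ \ \text{(vortex filament equation, VFE; it reads } \gamma_t=\tfrac12\gamma_x\times\gamma_{xx} \text{ when } \|\gamma_x\|=1).$$ Solutions are smooth, consist of immersed curves, and are defined for times in an open interval $J$ (an interval $I$ below is also open). 1. The geometric Airy flow preserves total arc-length. (a) If $\gamma$ is a solution with $\gamma(x+L,t)=\gamma(x,t)$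 for some $L>0$, then $\int_0^L\|\gamma_x(x,t)\|\,dx$ does not depend on $t\in J$. (b) If $\gamma$ is a solution for which $H(\gamma(\cdot,t))(x)\to0$ as $|x|\to\infty$, locally uniformly in $t$, then $\int_{\mathbb{R}}\|\gamma_x(x,t)\|\,dx\in[0,\infty]$ does not depend on $t\in J$, and for all $t_1,t_2\in J$, $\int_a^b\|\gamma_x(x,t_1)\|\,dx-\int_a^b\|\gamma_x(x,t_2)\|\,dx\to0$ as $a\to-\infty$ and $b\to\infty$. 2. The normalized geometric Airy flow preserves the arc-length parameter: if $\gamma$ is a solution, then $\|\gamma_x(x,t)\|$ does not depend on $t\in J$, for every $x$. 3. The normalized geometric Airy flow commutes with the VFE. (a) As vector fields on the space of immersed curves: for every smooth immersed $\gamma:\mathbb{R}\to\mathbb{R}^3$ and every $x$, the derivatives $$\frac{d}{d\varepsilon}\Big|_{\varepsilon=0}X(\gamma+\varepsilon Y(\gamma))(x),\qquad \frac{d}{d\varepsilon}\Big|_{\varepsilon=0}Y(\gamma+\varepsilon X(\gamma))(x)$$ exist and are equal. (b) As flows: let $s_0\in I$, $t_0\in J$ and let $F:I\times J\times\mathbb{R}\to\mathbb{R}^3$,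 $(s,t,x)\mapsto F(s,t,x)$, be smooth, such that $F(s_0,t_0,\cdot)$ is parametrized by arc-length, and either the curves $F(s,t,\cdot)$ are closed with a common period $L>0$ in $x$, or their curvature vectors $H(F(s,t,\cdot))(x)$ are, with all their derivatives in $(s,t,x)$, rapidly decaying in $x$, locally uniformly in $(s,t)$. If $s\mapsto F(s,t_0,\cdot)$ is a solution of the VFE on $I$ and, for every $s\in I$, $t\mapsto F(s,t,\cdot)$ is a solution of the normalized geometric Airy flow on $J$, then for every $t\in J$, $s\mapsto F(s,t,\cdot)$ is a solution of the VFE on $I$. The same holds with the roles of the two flows exchanged. -/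

import Mathlib

open Set Filter Topology MeasureTheory
open scoped ContDiff

noncomputable section

namespace CurveFlow

/-- Euclidean three-space. -/
abbrev E3 : Type := EuclideanSpace ℝ (Fin 3)

/-- The cross product on Euclidean three-space. -/
def cross (u v : E3) : E3 := WithLp.toLp 2 (crossProduct u.ofLp v.ofLp)

/-- The unit tangent `e₀ = γ_x / ‖γ_x‖` of an immersed curve. -/
def unitTangent (γ : ℝ → E3) (x : ℝ) : E3 := ‖deriv γ x‖⁻¹ • deriv γ x

/-- `∇_{e₀} ξ` for a vector field `ξ` along `γ`: the Levi-Civita connection of Euclidean space is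
the flat one, so this is the arc-length derivative `‖γ_x‖⁻¹ ξ_x`. -/
def covDeriv (γ : ℝ → E3) (ξ : ℝ → E3) (x : ℝ) : E3 := ‖deriv γ x‖⁻¹ • deriv ξ x

/-- The mean curvature (that is, curvature) vector `H(γ) = ∇_{e₀} e₀`. -/
def meanCurvature (γ : ℝ → E3) : ℝ → E3 := covDeriv γ (unitTangent γ)

/-- The orthogonal projection of `v` onto the normal plane of `γ` at `x`. -/
def normalPart (γ : ℝ → E3) (x : ℝ) (v : E3) : E3 :=
  v - (inner ℝ (unitTangent γ x) v) • unitTangent γ x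

/-- The normal connection `∇^⊥_{e₀} ξ = (∇_{e₀} ξ)^⊥`. -/
def normalDeriv (γ : ℝ → E3) (ξ : ℝ → E3) (x : ℝ) : E3 := normalPart γ x (covDeriv γ ξ x)

/-- The geometric Airy field `-¼ ∇^⊥_{e₀} H(γ)`. -/
def airy (γ : ℝ → E3) (x : ℝ) : E3 := -((1 / 4 : ℝ) • normalDeriv γ (meanCurvature γ) x)

/-- The normalized geometric Airy field `-⅛ ‖H(γ)‖² e₀ - ¼ ∇^⊥_{e₀} H(γ)`. -/
def normalizedAiry (γ : ℝ → E3) (x : ℝ) : E3 :=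
  -((1 / 8 : ℝ) * ‖meanCurvature γ x‖ ^ 2) • unitTangent γ x
    - (1 / 4 : ℝ) • normalDeriv γ (meanCurvature γ) x

/-- The vortex filament field `½ e₀ × H(γ)`, which is `½ γ_x × γ_xx` on curves parametrized by
arc-length. -/
def vfe (γ : ℝ → E3) (x : ℝ) : E3 :=
  (1 / 2 : ℝ) • cross (unitTangent γ x) (meanCurvature γ x)

/-- `γ` (first argument the time in `J`, second the curve parameter) is a smooth solution of the
curve flow `γ_t = X(γ)` on the space of immersed curves. -/
structure IsSolution (X : (ℝ → E3) → ℝ → E3) (J : Set ℝ) (γ : ℝ → ℝ → E3) : Prop where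
  smooth : ContDiffOn ℝ ∞ (fun z : ℝ × ℝ => γ z.1 z.2) (J ×ˢ univ)
  immersed : ∀ t ∈ J, ∀ x, deriv (γ t) x ≠ 0
  eqn : ∀ t ∈ J, ∀ x, HasDerivAt (fun τ => γ τ x) (X (γ t) x) t

/-- Arc-length of `γ` from parameter `a` to parameter `b`. -/
def arcLength (γ : ℝ → E3) (a b : ℝ) : ℝ := ∫ x in a..b, ‖deriv γ x‖

/-- Total arc-length, in `[0, ∞]`, of a curve defined on the whole line. -/
def totalArcLength (γ : ℝ → E3) : ENNReal := ∫⁻ x, ENNReal.ofReal ‖deriv γ x‖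

/-- The vector fields `X` and `Y` on the space of curves commute at `γ`:
`dX_γ(Y(γ)) = dY_γ(X(γ))`, both directional derivatives existing at every parameter. -/
def BracketVanishesAt (X Y : (ℝ → E3) → ℝ → E3) (γ : ℝ → E3) : Prop :=
  ∀ x, ∃ d : E3,
    HasDerivAt (fun ε : ℝ => X (fun y => γ y + ε • Y γ y) x) d 0 ∧
    HasDerivAt (fun ε : ℝ => Y (fun y => γ y + ε • X γ y) x) d 0

/-- All curves `F s t` are closed, with a common period. -/
def ClosedFamily (I J : Set ℝ) (F : ℝ → ℝ → ℝ → E3) : Prop :=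
  ∃ L : ℝ, 0 < L ∧ ∀ s ∈ I, ∀ t ∈ J, ∀ x, F s t (x + L) = F s t x

/-- The curvature vectors of the curves `F s t` are rapidly decaying in the curve parameter, with
all derivatives in `(s, t, x)`, locally uniformly in the parameters `(s, t)`. -/
def RapidlyDecayingFamily (I J : Set ℝ) (F : ℝ → ℝ → ℝ → E3) : Prop :=
  ∀ n N : ℕ, ∀ K : Set (ℝ × ℝ), IsCompact K → K ⊆ I ×ˢ J → ∃ C : ℝ, ∀ p ∈ K, ∀ x : ℝ,
    |x| ^ N * ‖iteratedFDeriv ℝ n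
      (fun z : ℝ × ℝ × ℝ => meanCurvature (F z.1 z.2.1) z.2.2) (p.1, p.2, x)‖ ≤ C

/-- The flow of `X` carries solutions of `γ_s = Y(γ)` to solutions of `γ_s = Y(γ)`: if `F · t₀` is
a solution of the `Y`-flow, starting from a curve parametrized by arc-length, and each curve `F s t₀`
is evolved by the `X`-flow into `F s t`, then `F · t` solves the `Y`-flow for every `t`. In other
words, flowing by `Y` and then by `X` is the same as flowing by `X` and then by `Y`.
The curves are closed, or they have rapidly decaying curvature. -/
def CarriesSolutions (X Y : (ℝ → E3) → ℝ → E3) : Prop :=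
  ∀ (I J : Set ℝ) (s₀ t₀ : ℝ) (F : ℝ → ℝ → ℝ → E3),
    IsOpen I → I.OrdConnected → IsOpen J → J.OrdConnected → s₀ ∈ I → t₀ ∈ J →
    ContDiffOn ℝ ∞ (fun z : ℝ × ℝ × ℝ => F z.1 z.2.1 z.2.2) (I ×ˢ J ×ˢ univ) →
    (ClosedFamily I J F ∨ RapidlyDecayingFamily I J F) →
    (∀ x, ‖deriv (F s₀ t₀) x‖ = 1) →
    IsSolution Y I (fun s => F s t₀) →
    (∀ s ∈ I, IsSolution X J (F s)) →
    ∀ t ∈ J, IsSolution Y I (fun s => F s t)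

end CurveFlow

end

open Set Filter Topology MeasureTheory
open scoped ContDiff

noncomputable section

namespace CurveFlow

/-! ### The cross product -/

/-! Write e₀, H, H₁, H₂ for the unit tangent and its successive arc-length derivatives.
Differentiating |e₀| = 1 repeatedly gives ⟨e₀, H⟩ = 0, ⟨e₀, H₁⟩ = -|H|², ⟨e₀, H₂⟩ = -3⟨H, H₁⟩, and
these relations drive everything.

Lengths. Under a variation V the speed changes at the rate ⟨e₀, V_x⟩ (`dd_speed`). For V = -¼H₁ -
c|H|²e₀ this is the speed times (3/4 - 2c)⟨H, H₁⟩. The Airy field has c = 1/4, which leaves the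
exact derivative of |H|²/8, so arc-length changes only through boundary terms. The normalized field
has c = 3/8, and the rate is zero.

Commuting fields. A variation that preserves the speed commutes with arc-length differentiation, so
e₀, H, H₁ vary by the first three arc-length derivatives of V (`variation_frame`). The vanishing of
the bracket becomes a pointwise identity between vectors of ℝ³, `bracket_algebra`.

Commuting flows. Here a uniqueness argument is needed. Let X be the flow in t and Y the flow in s.
Both preserve the speed, so every curve of F is parametrized by arc-length. By the bracket identity,
W = F_s - Y(F) solves the linearization of the X-flow (`dT_sub_vfeField`, `dT_sub_airyField`); it
vanishes at t₀, and W_x ⊥ e₀. The density |W_x|² satisfies a balance law: its t-derivative is the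
x-derivative of a flux plus a remainder bounded by C|W_x|². The orthogonality W_x ⊥ e₀ is what keeps
higher derivatives of W out of the remainder. Gronwall's inequality on long intervals
(`energy_eq_zero`) gives W_x = 0 once the flux has small increments: over whole periods they vanish,
and for rapidly decaying curvature every term of the flux has a decaying factor. Then W_t = 0, hence
W = 0 (`linearAiry_eq_zero`, `linearVfe_eq_zero`). -/

theorem inner_eq_sum (u v : E3) : inner ℝ u v = u 0 * v 0 + u 1 * v 1 + u 2 * v 2 := by
  simp [PiLp.inner_apply, Fin.sum_univ_three, mul_comm]

@[simp] theorem cross_zero_apply (u v : E3) : cross u v 0 = u 1 * v 2 - u 2 * v 1 := by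
  simp [cross, cross_apply]

@[simp] theorem cross_one_apply (u v : E3) : cross u v 1 = u 2 * v 0 - u 0 * v 2 := by
  simp [cross, cross_apply]

@[simp] theorem cross_two_apply (u v : E3) : cross u v 2 = u 0 * v 1 - u 1 * v 0 := by
  simp [cross, cross_apply]

theorem ext_coord {u v : E3} (h0 : u 0 = v 0) (h1 : u 1 = v 1) (h2 : u 2 = v 2) : u = v := by
  ext i; fin_cases i <;> assumption

/-- Lagrange's identity. -/
theorem norm_cross_sq (u v : E3) :
    ‖cross u v‖ ^ 2 = ‖u‖ ^ 2 * ‖v‖ ^ 2 - (inner ℝ u v) ^ 2 := by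
  simp only [← real_inner_self_eq_norm_sq, inner_eq_sum, cross_zero_apply, cross_one_apply,
    cross_two_apply]
  ring

theorem norm_cross_le (u v : E3) : ‖cross u v‖ ≤ ‖u‖ * ‖v‖ := by
  apply abs_le_of_sq_le_sq' _ (by positivity) |>.2
  rw [mul_pow, norm_cross_sq]
  nlinarith [sq_nonneg (inner ℝ u v)]

/-- The cross product as a continuous bilinear map. -/
def crossL : E3 →L[ℝ] E3 →L[ℝ] E3 :=
  LinearMap.mkContinuous₂
    (LinearMap.mk₂ ℝ cross
      (fun u v w => ext_coord (by simp; ring) (by simp; ring) (by simp; ring))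
      (fun c u v => ext_coord (by simp; ring) (by simp; ring) (by simp; ring))
      (fun u v w => ext_coord (by simp; ring) (by simp; ring) (by simp; ring))
      (fun c u v => ext_coord (by simp; ring) (by simp; ring) (by simp; ring)))
    1 (fun u v => by simpa using norm_cross_le u v)

@[simp] theorem crossL_apply (u v : E3) : crossL u v = cross u v := rfl

@[simp] theorem inner_self_cross (u v : E3) : inner ℝ u (cross u v) = 0 := by
  simp [inner_eq_sum]; ring

@[simp] theorem inner_cross_self (u v : E3) : inner ℝ v (cross u v) = 0 := by
  simp [inner_eq_sum]; ring

@[simp] theorem cross_self (u : E3) : cross u u = 0 :=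
  ext_coord (by simp; ring) (by simp; ring) (by simp; ring)

theorem cross_smul_left (c : ℝ) (u w : E3) : cross (c • u) w = c • cross u w :=
  ext_coord (by simp; ring) (by simp; ring) (by simp; ring)

theorem cross_smul_right (c : ℝ) (u w : E3) : cross u (c • w) = c • cross u w :=
  ext_coord (by simp; ring) (by simp; ring) (by simp; ring)

/-- The cross product of `b ⊥ a` with `c`, in terms of the unit vector `a`. -/
theorem cross_eq_of_unit {a b c : E3} (h : inner ℝ a a = (1 : ℝ)) (hb : inner ℝ a b = (0 : ℝ)) :
    cross b c = (inner ℝ a (cross b c)) • a - (inner ℝ a c) • cross a b := by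
  -- In coordinates this is |a|² b × c - ⟨a, b⟩ a × c + ⟨a, c⟩ a × b = ⟨a, b × c⟩ a, valid for all
  -- a, b, c.
  simp only [inner_eq_sum] at *
  apply ext_coord
  · simp
    linear_combination (-(b 1 * c 2 - b 2 * c 1)) * h + (a 1 * c 2 - a 2 * c 1) * hb
  · simp
    linear_combination (-(b 2 * c 0 - b 0 * c 2)) * h + (a 2 * c 0 - a 0 * c 2) * hb
  · simp
    linear_combination (-(b 0 * c 1 - b 1 * c 0)) * h + (a 0 * c 1 - a 1 * c 0) * hb

/-- If `a` is a unit vector orthogonal to `w` and `h`, then `w × h` is parallel to `a`. -/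
theorem inner_cross_of_unit {a w h v : E3} (ha : inner ℝ a a = (1 : ℝ))
    (hw : inner ℝ a w = (0 : ℝ)) (hh : inner ℝ a h = (0 : ℝ)) :
    inner ℝ w (cross h v) = inner ℝ a (cross w h) * inner ℝ a v := by
  have := cross_eq_of_unit (c := h) ha hw
  rw [hh, zero_smul, sub_zero] at this
  have h2 : inner ℝ w (cross h v) = inner ℝ (cross w h) v := by
    simp [inner_eq_sum]; ring
  rw [h2, this, inner_smul_left, inner_smul_right, ha]
  simp

/-- The algebra behind the commutation of the two fields: `d/dε Y(γ + ε X)` equals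
`d/dε X(γ + ε Y)`, in terms of the jet of the unit tangent. -/
theorem bracket_algebra {a b c d e : E3} (haa : inner ℝ a a = (1 : ℝ))
    (hab : inner ℝ a b = (0 : ℝ)) (had : inner ℝ a d = -3 * (inner ℝ b c : ℝ)) :
    -((1 / 4 : ℝ) • ((1 / 2 : ℝ) • ((2 : ℝ) • cross b d + cross a e)))
      - ((3 / 8 : ℝ) * (2 * inner ℝ b ((1 / 2 : ℝ) • (cross b c + cross a d)))) • a
      - ((3 / 8 : ℝ) * inner ℝ b b) • ((1 / 2 : ℝ) • cross a c) =
    (1 / 2 : ℝ) • (cross (-((1 / 4 : ℝ) • d) - ((3 / 4 : ℝ) * inner ℝ b c) • a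
        - ((3 / 8 : ℝ) * inner ℝ b b) • b) b
      + cross a (-((1 / 4 : ℝ) • e) - ((3 / 4 : ℝ) * (inner ℝ c c + inner ℝ b d)) • a
        - ((3 / 2 : ℝ) * inner ℝ b c) • b - ((3 / 8 : ℝ) * inner ℝ b b) • c)) := by
  -- Once the scalar products are abstracted, the two sides differ by a multiple of the single
  -- relation b × d = ⟨a, b × d⟩ a + 3⟨b, c⟩ a × b.
  have key := cross_eq_of_unit (c := d) haa hab
  rw [had] at key
  have hi : inner ℝ b (cross a d) = -(inner ℝ a (cross b d) : ℝ) := by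
    simp [inner_eq_sum]; ring
  rw [inner_smul_right, inner_add_right, hi]
  rw [inner_self_cross]
  generalize inner ℝ a (cross b d) = p at *
  generalize (inner ℝ b c : ℝ) = q at *
  generalize (inner ℝ b b : ℝ) = r at *
  generalize (inner ℝ c c + inner ℝ b d : ℝ) = s at *
  have k0 := congrArg (fun v : E3 => v 0) key
  have k1 := congrArg (fun v : E3 => v 1) key
  have k2 := congrArg (fun v : E3 => v 2) key
  simp at k0 k1 k2
  apply ext_coord
  · simp; linear_combination (-3 / 8) * k0
  · simp; linear_combination (-3 / 8) * k1
  · simp; linear_combination (-3 / 8) * k2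

/-! ### Calculus along curves -/

theorem _root_.HasDerivAt.cross {f g : ℝ → E3} {f' g' : E3} {x : ℝ} (hf : HasDerivAt f f' x)
    (hg : HasDerivAt g g' x) :
    HasDerivAt (fun y => cross (f y) (g y)) (cross f' (g x) + cross (f x) g') x := by
  have := crossL.hasDerivAt_of_bilinear (fun _ => hf) (fun _ => hg)
  simpa [add_comm] using this

theorem _root_.ContDiffOn.cross {P : Type*} [NormedAddCommGroup P] [NormedSpace ℝ P] {n : ℕ∞ω}
    {f g : P → E3} {s : Set P} (hf : ContDiffOn ℝ n f s) (hg : ContDiffOn ℝ n g s) :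
    ContDiffOn ℝ n (fun p => cross (f p) (g p)) s :=
  (crossL.contDiff.comp_contDiffOn hf).clm_apply hg

theorem _root_.ContDiff.cross {P : Type*} [NormedAddCommGroup P] [NormedSpace ℝ P] {n : ℕ∞ω}
    {f g : P → E3} (hf : ContDiff ℝ n f) (hg : ContDiff ℝ n g) :
    ContDiff ℝ n (fun p => cross (f p) (g p)) :=
  (crossL.contDiff.comp hf).clm_apply hg

/-! ### Directional derivatives of functions on an open set -/

section dd

variable {P E : Type*} [NormedAddCommGroup P] [NormedSpace ℝ P] [NormedAddCommGroup E]
  [NormedSpace ℝ E] {Ω : Set P} {G G' : P → E} {p : P}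

/-- The derivative of `G` in the direction `v`. -/
def dd (v : P) (G : P → E) (p : P) : E := fderiv ℝ G p v

theorem contDiffOn_dd (hΩ : IsOpen Ω) (hG : ContDiffOn ℝ ∞ G Ω) (v : P) :
    ContDiffOn ℝ ∞ (dd v G) Ω :=
  (hG.fderiv_of_isOpen hΩ (by simp)).clm_apply contDiffOn_const

theorem differentiableAt_of_contDiffOn (hΩ : IsOpen Ω) (hG : ContDiffOn ℝ ∞ G Ω) (hp : p ∈ Ω) :
    DifferentiableAt ℝ G p :=
  (hG.contDiffAt (hΩ.mem_nhds hp)).differentiableAt (by simp)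

theorem dd_comm (hΩ : IsOpen Ω) (hG : ContDiffOn ℝ ∞ G Ω) (hp : p ∈ Ω) (u v : P) :
    dd u (dd v G) p = dd v (dd u G) p := by
  have hd : DifferentiableAt ℝ (fderiv ℝ G) p :=
    differentiableAt_of_contDiffOn hΩ (hG.fderiv_of_isOpen hΩ (by simp)) hp
  have key : ∀ a b : P, dd a (dd b G) p = fderiv ℝ (fderiv ℝ G) p a b := by
    intro a b
    have : HasFDerivAt (dd b G) ((ContinuousLinearMap.apply ℝ E b).comp
        (fderiv ℝ (fderiv ℝ G) p)) p :=
      (ContinuousLinearMap.apply ℝ E b).hasFDerivAt.comp p hd.hasFDerivAt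
    rw [dd, this.fderiv]; rfl
  rw [key, key]
  exact ((hG.contDiffAt (hΩ.mem_nhds hp)).isSymmSndFDerivAt (by
    rw [minSmoothness_of_isRCLikeNormedField]; exact WithTop.coe_le_coe.2 le_top)) u v

theorem dd_congr (hΩ : IsOpen Ω) (h : ∀ q ∈ Ω, G q = G' q) (v : P) :
    ∀ q ∈ Ω, dd v G q = dd v G' q := by
  intro q hq
  have : G =ᶠ[𝓝 q] G' := by filter_upwards [hΩ.mem_nhds hq] with r hr using h r hr
  rw [dd, dd, this.fderiv_eq]

theorem hasDerivAt_line (hG : DifferentiableAt ℝ G p) (v : P) :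
    HasDerivAt (fun r : ℝ => G (p + r • v)) (dd v G p) 0 := by
  have h1 : HasDerivAt (fun r : ℝ => p + r • v) v 0 := by
    simpa using ((hasDerivAt_id (0 : ℝ)).smul_const v).const_add p
  have h2 : HasFDerivAt G (fderiv ℝ G p) (p + (0 : ℝ) • v) := by simpa using hG.hasFDerivAt
  exact h2.comp_hasDerivAt 0 h1

/-- Reduces the calculus rules for `dd` to the one-variable rules along the line through `p` in the
direction `v`. -/
theorem dd_eq_of_line {v : P} {d : E} (hG : DifferentiableAt ℝ G p)
    (h : HasDerivAt (fun r : ℝ => G (p + r • v)) d 0) : dd v G p = d :=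
  (hasDerivAt_line hG v).unique h

theorem dd_cross {f g : P → E3} (hf : DifferentiableAt ℝ f p) (hg : DifferentiableAt ℝ g p)
    (v : P) : dd v (fun q => cross (f q) (g q)) p
      = cross (dd v f p) (g p) + cross (f p) (dd v g p) := by
  have h : DifferentiableAt ℝ (fun q => cross (f q) (g q)) p :=
    (crossL.differentiableAt.comp p hf).clm_apply hg
  refine dd_eq_of_line h ?_
  simpa using (hasDerivAt_line hf v).cross (hasDerivAt_line hg v)

theorem dd_inner {f g : P → E3} (hf : DifferentiableAt ℝ f p) (hg : DifferentiableAt ℝ g p)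
    (v : P) : dd v (fun q => (inner ℝ (f q) (g q) : ℝ)) p
      = inner ℝ (dd v f p) (g p) + inner ℝ (f p) (dd v g p) := by
  refine dd_eq_of_line (hf.inner ℝ hg) ?_
  simpa [add_comm] using (hasDerivAt_line hf v).inner ℝ (hasDerivAt_line hg v)

theorem dd_add (hf : DifferentiableAt ℝ G p) (hg : DifferentiableAt ℝ G' p)
    (v : P) : dd v (fun q => G q + G' q) p = dd v G p + dd v G' p :=
  dd_eq_of_line (hf.add hg) ((hasDerivAt_line hf v).add (hasDerivAt_line hg v))

theorem dd_sub (hf : DifferentiableAt ℝ G p) (hg : DifferentiableAt ℝ G' p)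
    (v : P) : dd v (fun q => G q - G' q) p = dd v G p - dd v G' p :=
  dd_eq_of_line (hf.sub hg) ((hasDerivAt_line hf v).sub (hasDerivAt_line hg v))

theorem dd_neg (hf : DifferentiableAt ℝ G p) (v : P) : dd v (fun q => -G q) p = -dd v G p :=
  dd_eq_of_line hf.neg (hasDerivAt_line hf v).neg

theorem dd_const_smul (hf : DifferentiableAt ℝ G p) (c : ℝ) (v : P) :
    dd v (fun q => c • G q) p = c • dd v G p :=
  dd_eq_of_line (hf.const_smul c) ((hasDerivAt_line hf v).const_smul c)

theorem dd_smul {f : P → ℝ} (hf : DifferentiableAt ℝ f p) (hg : DifferentiableAt ℝ G p)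
    (v : P) : dd v (fun q => f q • G q) p = dd v f p • G p + f p • dd v G p := by
  refine dd_eq_of_line (hf.smul hg) ?_
  have := (hasDerivAt_line hf v).smul (hasDerivAt_line hg v)
  simp only [zero_smul, add_zero] at this
  rw [add_comm]
  exact this

theorem dd_const_mul {f : P → ℝ} (hf : DifferentiableAt ℝ f p) (c : ℝ) (v : P) :
    dd v (fun q => c * f q) p = c * dd v f p :=
  dd_eq_of_line (hf.const_mul c) ((hasDerivAt_line hf v).const_mul c)

/-- Comes from differentiating ⟨f, f⟩ = ‖f‖² in both forms. -/
theorem dd_norm {f : P → E3} (hf : DifferentiableAt ℝ f p) (h0 : f p ≠ 0) (v : P) :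
    dd v (fun q => ‖f q‖) p = ‖f p‖⁻¹ * inner ℝ (f p) (dd v f p) := by
  have hd : DifferentiableAt ℝ (fun q => ‖f q‖) p := hf.norm ℝ h0
  have h1 : dd v (fun q => (inner ℝ (f q) (f q) : ℝ)) p =
      2 * (‖f p‖ * dd v (fun q => ‖f q‖) p) := by
    have e : (fun q => (inner ℝ (f q) (f q) : ℝ)) = fun q => ‖f q‖ • ‖f q‖ := by
      ext q; simp [sq]
    rw [e, dd_smul hd hd]
    simp only [smul_eq_mul]; ring
  rw [dd_inner hf hf, real_inner_comm (f p)] at h1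
  have : ‖f p‖ ≠ 0 := norm_ne_zero_iff.2 h0
  field_simp
  linarith

end dd

/-! ### Arc-length calculus on an immersed curve -/

section curve

variable {γ : ℝ → E3}

theorem covDeriv_eq_dd (γ ξ : ℝ → E3) (x : ℝ) :
    covDeriv γ ξ x = ‖deriv γ x‖⁻¹ • dd (1 : ℝ) ξ x := rfl

theorem covDeriv_congr {ξ ξ' : ℝ → E3} {x : ℝ} (h : ξ =ᶠ[𝓝 x] ξ') :
    covDeriv γ ξ x = covDeriv γ ξ' x := by
  rw [covDeriv, covDeriv, h.deriv_eq]

theorem contDiff_norm_deriv_inv (hγ : ContDiff ℝ ∞ γ) (h0 : ∀ x, deriv γ x ≠ 0) :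
    ContDiff ℝ ∞ (fun x => ‖deriv γ x‖⁻¹) := by
  have h1 : ContDiff ℝ ∞ (deriv γ) := hγ.deriv'
  exact (h1.norm ℝ h0).inv (fun x => norm_ne_zero_iff.2 (h0 x))

theorem contDiff_covDeriv (hγ : ContDiff ℝ ∞ γ) (h0 : ∀ x, deriv γ x ≠ 0) {ξ : ℝ → E3}
    (hξ : ContDiff ℝ ∞ ξ) : ContDiff ℝ ∞ (covDeriv γ ξ) := by
  have h1 : ContDiff ℝ ∞ (deriv ξ) := hξ.deriv'
  exact (contDiff_norm_deriv_inv hγ h0).smul h1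

theorem contDiff_unitTangent (hγ : ContDiff ℝ ∞ γ) (h0 : ∀ x, deriv γ x ≠ 0) :
    ContDiff ℝ ∞ (unitTangent γ) := contDiff_covDeriv hγ h0 hγ

theorem contDiff_meanCurvature (hγ : ContDiff ℝ ∞ γ) (h0 : ∀ x, deriv γ x ≠ 0) :
    ContDiff ℝ ∞ (meanCurvature γ) := contDiff_covDeriv hγ h0 (contDiff_unitTangent hγ h0)

theorem covDeriv_cross {u v : ℝ → E3} {x : ℝ} (hu : DifferentiableAt ℝ u x)
    (hv : DifferentiableAt ℝ v x) : covDeriv γ (fun y => cross (u y) (v y)) x =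
      cross (covDeriv γ u x) (v x) + cross (u x) (covDeriv γ v x) := by
  simp only [covDeriv_eq_dd, dd_cross hu hv, smul_add, cross_smul_left, cross_smul_right]

theorem covDeriv_inner {u v : ℝ → E3} {x : ℝ} (hu : DifferentiableAt ℝ u x)
    (hv : DifferentiableAt ℝ v x) :
    ‖deriv γ x‖⁻¹ * dd (1 : ℝ) (fun y => (inner ℝ (u y) (v y) : ℝ)) x =
      inner ℝ (covDeriv γ u x) (v x) + inner ℝ (u x) (covDeriv γ v x) := by
  simp only [covDeriv_eq_dd, dd_inner hu hv, inner_smul_left, inner_smul_right]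
  simp; ring

theorem covDeriv_add {u v : ℝ → E3} {x : ℝ} (hu : DifferentiableAt ℝ u x)
    (hv : DifferentiableAt ℝ v x) : covDeriv γ (fun y => u y + v y) x =
      covDeriv γ u x + covDeriv γ v x := by
  simp only [covDeriv_eq_dd, dd_add hu hv, smul_add]

theorem covDeriv_sub {u v : ℝ → E3} {x : ℝ} (hu : DifferentiableAt ℝ u x)
    (hv : DifferentiableAt ℝ v x) : covDeriv γ (fun y => u y - v y) x =
      covDeriv γ u x - covDeriv γ v x := by
  simp only [covDeriv_eq_dd, dd_sub hu hv, smul_sub]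

theorem covDeriv_neg {u : ℝ → E3} {x : ℝ} (hu : DifferentiableAt ℝ u x) :
    covDeriv γ (fun y => -u y) x = -covDeriv γ u x := by
  simp only [covDeriv_eq_dd, dd_neg hu, smul_neg]

theorem covDeriv_const_smul {u : ℝ → E3} {x : ℝ} (c : ℝ) (hu : DifferentiableAt ℝ u x) :
    covDeriv γ (fun y => c • u y) x = c • covDeriv γ u x := by
  simp only [covDeriv_eq_dd, dd_const_smul hu, smul_comm _ c]

theorem covDeriv_inner_smul {u v w : ℝ → E3} {x : ℝ} (c : ℝ) (hu : DifferentiableAt ℝ u x)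
    (hv : DifferentiableAt ℝ v x) (hw : DifferentiableAt ℝ w x) :
    covDeriv γ (fun y => (c * inner ℝ (u y) (v y)) • w y) x =
      (c * (inner ℝ (covDeriv γ u x) (v x) + inner ℝ (u x) (covDeriv γ v x))) • w x
        + (c * inner ℝ (u x) (v x)) • covDeriv γ w x := by
  rw [← covDeriv_inner hu hv]
  rw [covDeriv_eq_dd, dd_smul ((hu.inner ℝ hv).const_mul c) hw, dd_const_mul (hu.inner ℝ hv),
    covDeriv_eq_dd]
  module

/-- The covariant derivative of the mean curvature vector. -/
def curvature₁ (γ : ℝ → E3) : ℝ → E3 := covDeriv γ (meanCurvature γ)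
/-- The second covariant derivative of the mean curvature vector. -/
def curvature₂ (γ : ℝ → E3) : ℝ → E3 := covDeriv γ (curvature₁ γ)

/-! ### Orthogonality relations of the frame, and derivatives of the three fields -/

section frame

variable (hγ : ContDiff ℝ ∞ γ) (h0 : ∀ x, deriv γ x ≠ 0)
include hγ h0

theorem contDiff_curvature₁ : ContDiff ℝ ∞ (curvature₁ γ) :=
  contDiff_covDeriv hγ h0 (contDiff_meanCurvature hγ h0)

theorem contDiff_curvature₂ : ContDiff ℝ ∞ (curvature₂ γ) :=
  contDiff_covDeriv hγ h0 (contDiff_curvature₁ hγ h0)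

theorem differentiable_frame : Differentiable ℝ (unitTangent γ) ∧
    Differentiable ℝ (meanCurvature γ) ∧ Differentiable ℝ (curvature₁ γ) ∧
    Differentiable ℝ (curvature₂ γ) :=
  ⟨(contDiff_unitTangent hγ h0).differentiable (by simp),
    (contDiff_meanCurvature hγ h0).differentiable (by simp),
    (contDiff_curvature₁ hγ h0).differentiable (by simp),
    (contDiff_curvature₂ hγ h0).differentiable (by simp)⟩

omit hγ in
theorem inner_tangent_self (x : ℝ) : inner ℝ (unitTangent γ x) (unitTangent γ x) = (1 : ℝ) := by
  have : ‖deriv γ x‖ ≠ 0 := norm_ne_zero_iff.2 (h0 x)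
  rw [unitTangent, inner_smul_left, inner_smul_right, real_inner_self_eq_norm_mul_norm]
  simp
  field_simp

omit hγ h0 in
theorem inner_covDeriv_const {u v : ℝ → E3} (hu : Differentiable ℝ u) (hv : Differentiable ℝ v)
    {c : ℝ} (h : ∀ x, inner ℝ (u x) (v x) = c) (x : ℝ) :
    (inner ℝ (covDeriv γ u x) (v x) + inner ℝ (u x) (covDeriv γ v x) : ℝ) = 0 := by
  rw [← covDeriv_inner (hu x) (hv x)]
  simp [h, dd]

theorem inner_tangent_meanCurvature (x : ℝ) :
    inner ℝ (unitTangent γ x) (meanCurvature γ x) = (0 : ℝ) := by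
  obtain ⟨d0, d1, d2, d3⟩ := differentiable_frame hγ h0
  have := inner_covDeriv_const (γ := γ) d0 d0 (inner_tangent_self h0) x
  rw [real_inner_comm] at this
  change (inner ℝ (unitTangent γ x) (meanCurvature γ x)
    + inner ℝ (unitTangent γ x) (meanCurvature γ x) : ℝ) = 0 at this
  linarith

theorem inner_tangent_curvature₁ (x : ℝ) :
    inner ℝ (unitTangent γ x) (curvature₁ γ x)
      = -(inner ℝ (meanCurvature γ x) (meanCurvature γ x) : ℝ) := by
  obtain ⟨d0, d1, d2, d3⟩ := differentiable_frame hγ h0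
  have := inner_covDeriv_const (γ := γ) d0 d1 (inner_tangent_meanCurvature hγ h0) x
  change (inner ℝ (meanCurvature γ x) (meanCurvature γ x)
    + inner ℝ (unitTangent γ x) (curvature₁ γ x) : ℝ) = 0 at this
  linarith

/-- The derivative of ⟨e₀, H₁⟩ = -|H|² reads ⟨H, H₁⟩ + ⟨e₀, H₂⟩ = -2⟨H, H₁⟩. -/
theorem inner_tangent_curvature₂ (x : ℝ) :
    inner ℝ (unitTangent γ x) (curvature₂ γ x)
      = -3 * (inner ℝ (meanCurvature γ x) (curvature₁ γ x) : ℝ) := by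
  obtain ⟨d0, d1, d2, d3⟩ := differentiable_frame hγ h0
  have e1 := covDeriv_inner (γ := γ) (d0 x) (d2 x)
  have e2 := covDeriv_inner (γ := γ) (d1 x) (d1 x)
  have : (fun y => (inner ℝ (unitTangent γ y) (curvature₁ γ y) : ℝ))
      = fun y => -(inner ℝ (meanCurvature γ y) (meanCurvature γ y) : ℝ) :=
    funext (inner_tangent_curvature₁ hγ h0)
  rw [this, dd_neg ((d1 x).inner ℝ (d1 x)), mul_neg, e2] at e1
  change -(inner ℝ (curvature₁ γ x) (meanCurvature γ x)
    + inner ℝ (meanCurvature γ x) (curvature₁ γ x) : ℝ)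
    = inner ℝ (meanCurvature γ x) (curvature₁ γ x)
    + inner ℝ (unitTangent γ x) (curvature₂ γ x) at e1
  rw [real_inner_comm] at e1
  linarith

theorem normalDeriv_meanCurvature (x : ℝ) : normalDeriv γ (meanCurvature γ) x = curvature₁ γ x
    + (inner ℝ (meanCurvature γ x) (meanCurvature γ x) : ℝ) • unitTangent γ x := by
  change curvature₁ γ x - (inner ℝ (unitTangent γ x) (curvature₁ γ x)) • unitTangent γ x = _
  rw [inner_tangent_curvature₁ hγ h0]
  module

theorem airy_eq : airy γ = fun x => -((1 / 4 : ℝ) • curvature₁ γ x)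
    - ((1 / 4 : ℝ) * inner ℝ (meanCurvature γ x) (meanCurvature γ x)) • unitTangent γ x := by
  ext1 x
  rw [airy, normalDeriv_meanCurvature hγ h0]
  module

/-- The coefficient is 3/8 = 1/8 + 1/4: removing the tangential part of H₁ contributes the extra
¼|H|². -/
theorem normalizedAiry_eq : normalizedAiry γ = fun x => -((1 / 4 : ℝ) • curvature₁ γ x)
    - ((3 / 8 : ℝ) * inner ℝ (meanCurvature γ x) (meanCurvature γ x)) • unitTangent γ x := by
  ext1 x
  rw [normalizedAiry, normalDeriv_meanCurvature hγ h0, ← real_inner_self_eq_norm_sq]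
  module

/-- The arc-length derivative of `-¼ H₁ - c |H|² e₀`. -/
theorem covDeriv_airyType (c : ℝ) : covDeriv γ (fun x => -((1 / 4 : ℝ) • curvature₁ γ x)
    - (c * inner ℝ (meanCurvature γ x) (meanCurvature γ x)) • unitTangent γ x) = fun x =>
    -((1 / 4 : ℝ) • curvature₂ γ x)
      - ((2 * c) * inner ℝ (meanCurvature γ x) (curvature₁ γ x)) • unitTangent γ x
      - (c * inner ℝ (meanCurvature γ x) (meanCurvature γ x)) • meanCurvature γ x := by
  obtain ⟨d0, d1, d2, d3⟩ := differentiable_frame hγ h0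
  ext1 x
  rw [covDeriv_sub ((d2 x).fun_const_smul _).fun_neg
    ((((d1 x).inner ℝ (d1 x)).const_mul c).fun_smul (d0 x)), covDeriv_neg ((d2 x).fun_const_smul _),
    covDeriv_const_smul _ (d2 x), covDeriv_inner_smul c (d1 x) (d1 x) (d0 x)]
  change -((1 / 4 : ℝ) • curvature₂ γ x) - ((c * (inner ℝ (curvature₁ γ x) (meanCurvature γ x)
    + inner ℝ (meanCurvature γ x) (curvature₁ γ x))) • unitTangent γ x
    + (c * inner ℝ (meanCurvature γ x) (meanCurvature γ x)) • meanCurvature γ x) = _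
  rw [real_inner_comm]
  module

theorem covDeriv_normalizedAiry : covDeriv γ (normalizedAiry γ) = fun x =>
    -((1 / 4 : ℝ) • curvature₂ γ x)
      - ((3 / 4 : ℝ) * inner ℝ (meanCurvature γ x) (curvature₁ γ x)) • unitTangent γ x
      - ((3 / 8 : ℝ) * inner ℝ (meanCurvature γ x) (meanCurvature γ x)) • meanCurvature γ x := by
  rw [normalizedAiry_eq hγ h0, covDeriv_airyType hγ h0]
  norm_num

theorem covDeriv_covDeriv_normalizedAiry : covDeriv γ (covDeriv γ (normalizedAiry γ)) = fun x =>
    -((1 / 4 : ℝ) • covDeriv γ (curvature₂ γ) x)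
      - ((3 / 4 : ℝ) * (inner ℝ (curvature₁ γ x) (curvature₁ γ x)
        + inner ℝ (meanCurvature γ x) (curvature₂ γ x))) • unitTangent γ x
      - ((3 / 2 : ℝ) * inner ℝ (meanCurvature γ x) (curvature₁ γ x)) • meanCurvature γ x
      - ((3 / 8 : ℝ) * inner ℝ (meanCurvature γ x) (meanCurvature γ x)) • curvature₁ γ x := by
  obtain ⟨d0, d1, d2, d3⟩ := differentiable_frame hγ h0
  rw [covDeriv_normalizedAiry hγ h0]
  ext1 x
  have s1 := (((d1 x).inner ℝ (d2 x)).const_mul (3 / 4)).fun_smul (d0 x)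
  have s2 := (((d1 x).inner ℝ (d1 x)).const_mul (3 / 8)).fun_smul (d1 x)
  rw [covDeriv_sub (((d3 x).fun_const_smul _).fun_neg.fun_sub s1) s2,
    covDeriv_sub ((d3 x).fun_const_smul _).fun_neg s1, covDeriv_neg ((d3 x).fun_const_smul _),
    covDeriv_const_smul _ (d3 x), covDeriv_inner_smul _ (d1 x) (d2 x) (d0 x),
    covDeriv_inner_smul _ (d1 x) (d1 x) (d1 x)]
  change -((1 / 4 : ℝ) • covDeriv γ (curvature₂ γ) x)
    - (((3 / 4 : ℝ) * (inner ℝ (curvature₁ γ x) (curvature₁ γ x)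
      + inner ℝ (meanCurvature γ x) (curvature₂ γ x))) • unitTangent γ x
      + ((3 / 4 : ℝ) * inner ℝ (meanCurvature γ x) (curvature₁ γ x)) • meanCurvature γ x)
    - (((3 / 8 : ℝ) * (inner ℝ (curvature₁ γ x) (meanCurvature γ x)
      + inner ℝ (meanCurvature γ x) (curvature₁ γ x))) • meanCurvature γ x
      + ((3 / 8 : ℝ) * inner ℝ (meanCurvature γ x) (meanCurvature γ x)) • curvature₁ γ x) = _
  rw [real_inner_comm (meanCurvature γ x) (curvature₁ γ x)]
  module

theorem covDeriv_vfe : covDeriv γ (vfe γ) =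
    fun x => (1 / 2 : ℝ) • cross (unitTangent γ x) (curvature₁ γ x) := by
  obtain ⟨d0, d1, d2, d3⟩ := differentiable_frame hγ h0
  ext1 x
  have := (contDiff_unitTangent hγ h0).cross (contDiff_meanCurvature hγ h0)
  unfold vfe
  rw [covDeriv_const_smul _ (this.differentiable (by simp) x), covDeriv_cross (d0 x) (d1 x)]
  change (1 / 2 : ℝ) • (cross (meanCurvature γ x) (meanCurvature γ x)
    + cross (unitTangent γ x) (curvature₁ γ x)) = _
  simp

theorem covDeriv_covDeriv_vfe : covDeriv γ (covDeriv γ (vfe γ)) =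
    fun x => (1 / 2 : ℝ) • (cross (meanCurvature γ x) (curvature₁ γ x)
      + cross (unitTangent γ x) (curvature₂ γ x)) := by
  obtain ⟨d0, d1, d2, d3⟩ := differentiable_frame hγ h0
  rw [covDeriv_vfe hγ h0]
  ext1 x
  have := (contDiff_unitTangent hγ h0).cross (contDiff_curvature₁ hγ h0)
  rw [covDeriv_const_smul _ (this.differentiable (by simp) x), covDeriv_cross (d0 x) (d2 x)]
  rfl

theorem covDeriv_covDeriv_covDeriv_vfe : covDeriv γ (covDeriv γ (covDeriv γ (vfe γ))) =
    fun x => (1 / 2 : ℝ) • ((2 : ℝ) • cross (meanCurvature γ x) (curvature₂ γ x)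
      + cross (unitTangent γ x) (covDeriv γ (curvature₂ γ) x)) := by
  obtain ⟨d0, d1, d2, d3⟩ := differentiable_frame hγ h0
  rw [covDeriv_covDeriv_vfe hγ h0]
  ext1 x
  have c1 := ((contDiff_meanCurvature hγ h0).cross
    (contDiff_curvature₁ hγ h0)).differentiable (by simp) x
  have c2 := ((contDiff_unitTangent hγ h0).cross
    (contDiff_curvature₂ hγ h0)).differentiable (by simp) x
  rw [covDeriv_const_smul _ (c1.fun_add c2), covDeriv_add c1 c2, covDeriv_cross (d0 x) (d3 x),
    covDeriv_cross (d1 x) (d2 x)]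
  change (1 / 2 : ℝ) • (cross (curvature₁ γ x) (curvature₁ γ x)
    + cross (meanCurvature γ x) (curvature₂ γ x) + (cross (meanCurvature γ x) (curvature₂ γ x)
    + cross (unitTangent γ x) (covDeriv γ (curvature₂ γ) x))) = _
  rw [cross_self]
  module

omit hγ in
theorem inner_deriv_eq (ξ : ℝ → E3) (x : ℝ) : (inner ℝ (unitTangent γ x) (deriv ξ x) : ℝ)
    = ‖deriv γ x‖ * inner ℝ (unitTangent γ x) (covDeriv γ ξ x) := by
  have : ‖deriv γ x‖ ≠ 0 := norm_ne_zero_iff.2 (h0 x)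
  rw [covDeriv, inner_smul_right]
  field_simp

/-- With c = 1/4 the tangential part of the arc-length derivative is (3/4 - 2c)⟨H, H₁⟩ = ¼⟨H, H₁⟩,
an exact derivative. This makes the rate of change of arc-length a boundary term. -/
theorem inner_tangent_deriv_airy (x : ℝ) : (inner ℝ (unitTangent γ x) (deriv (airy γ) x) : ℝ)
    = deriv (fun y => (1 / 8 : ℝ) * ‖meanCurvature γ y‖ ^ 2) x := by
  obtain ⟨d0, d1, d2, d3⟩ := differentiable_frame hγ h0
  have hn : ‖deriv γ x‖ ≠ 0 := norm_ne_zero_iff.2 (h0 x)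
  have e := covDeriv_inner (γ := γ) (d1 x) (d1 x)
  change ‖deriv γ x‖⁻¹ * deriv (fun y => (inner ℝ (meanCurvature γ y) (meanCurvature γ y) : ℝ)) x
    = inner ℝ (curvature₁ γ x) (meanCurvature γ x)
      + inner ℝ (meanCurvature γ x) (curvature₁ γ x) at e
  simp only [← real_inner_self_eq_norm_sq]
  rw [deriv_const_mul _ ((d1 x).inner ℝ (d1 x)), inner_deriv_eq h0, airy_eq hγ h0,
    covDeriv_airyType hγ h0]
  simp only [inner_sub_right, inner_neg_right, inner_smul_right, inner_tangent_self h0,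
    inner_tangent_meanCurvature hγ h0, inner_tangent_curvature₂ hγ h0]
  rw [real_inner_comm] at e
  field_simp at e
  rw [e]
  ring

/-- The value c = 3/8 is the zero of 3/4 - 2c. -/
theorem inner_tangent_deriv_normalizedAiry (x : ℝ) :
    inner ℝ (unitTangent γ x) (deriv (normalizedAiry γ) x) = (0 : ℝ) := by
  rw [inner_deriv_eq h0, covDeriv_normalizedAiry hγ h0]
  simp only [inner_sub_right, inner_neg_right, inner_smul_right, inner_tangent_self h0,
    inner_tangent_meanCurvature hγ h0, inner_tangent_curvature₂ hγ h0]
  ring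

/-- Since H × H = 0, only ½ e₀ × H₁ survives differentiation, and it is orthogonal to e₀. -/
theorem inner_tangent_deriv_vfe (x : ℝ) :
    inner ℝ (unitTangent γ x) (deriv (vfe γ) x) = (0 : ℝ) := by
  rw [inner_deriv_eq h0, covDeriv_vfe hγ h0, inner_smul_right, inner_self_cross]
  ring

theorem contDiff_normalizedAiry : ContDiff ℝ ∞ (normalizedAiry γ) := by
  rw [normalizedAiry_eq hγ h0]
  have := contDiff_unitTangent hγ h0
  have := contDiff_meanCurvature hγ h0
  have := contDiff_curvature₁ hγ h0
  have : ContDiff ℝ ∞ fun x => (inner ℝ (meanCurvature γ x) (meanCurvature γ x) : ℝ) :=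
    ContDiff.inner ℝ ‹_› ‹_›
  fun_prop

theorem contDiff_vfe : ContDiff ℝ ∞ (vfe γ) :=
  ((contDiff_unitTangent hγ h0).cross (contDiff_meanCurvature hγ h0)).const_smul (1 / 2 : ℝ)

end frame

end curve

/-! ### Variations of curves -/

section variation

variable {Ω : Set (ℝ × ℝ)} {G : ℝ × ℝ → E3}

section slice

variable {E : Type*} [NormedAddCommGroup E] [NormedSpace ℝ E] {f : ℝ × ℝ → E}

theorem hasDerivAt_fst {t x : ℝ} (hf : DifferentiableAt ℝ f (t, x)) :
    HasDerivAt (fun r => f (r, x)) (dd (1, 0) f (t, x)) t := by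
  have h : HasDerivAt (fun r : ℝ => (r, x)) ((1 : ℝ), (0 : ℝ)) t :=
    (hasDerivAt_id t).prodMk (hasDerivAt_const t x)
  exact hf.hasFDerivAt.comp_hasDerivAt t h

theorem hasDerivAt_snd {t x : ℝ} (hf : DifferentiableAt ℝ f (t, x)) :
    HasDerivAt (fun y => f (t, y)) (dd (0, 1) f (t, x)) x := by
  have h : HasDerivAt (fun r : ℝ => (t, r)) ((0 : ℝ), (1 : ℝ)) x :=
    (hasDerivAt_const x t).prodMk (hasDerivAt_id x)
  exact hf.hasFDerivAt.comp_hasDerivAt x h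

end slice

/-- The covariant derivative along the curves `G (t, ·)`, of a field on the parameter plane. -/
def planeDeriv (G ξ : ℝ × ℝ → E3) (p : ℝ × ℝ) : E3 :=
  ‖dd (0, 1) G p‖⁻¹ • dd (0, 1) ξ p

theorem contDiffOn_planeDeriv (hΩ : IsOpen Ω) (hG : ContDiffOn ℝ ∞ G Ω)
    (h0 : ∀ p ∈ Ω, dd (0, 1) G p ≠ 0) {ξ : ℝ × ℝ → E3} (hξ : ContDiffOn ℝ ∞ ξ Ω) :
    ContDiffOn ℝ ∞ (planeDeriv G ξ) Ω :=
  ((((contDiffOn_dd hΩ hG _).norm ℝ h0).inv (fun p hp => norm_ne_zero_iff.2 (h0 p hp)))).smul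
    (contDiffOn_dd hΩ hξ _)

/-- Agreement of `ζ` and `ξ` is required only inside the open set `Ω`, because a curve of the family
may fail to be immersed elsewhere. -/
theorem covDeriv_slice (hΩ : IsOpen Ω) (hG : ContDiffOn ℝ ∞ G Ω)
    {ξ : ℝ × ℝ → E3} (hξ : ContDiffOn ℝ ∞ ξ Ω) {ζ : ℝ → E3} {t x : ℝ}
    (h : ∀ y, (t, y) ∈ Ω → ζ y = ξ (t, y)) (hp : (t, x) ∈ Ω) :
    covDeriv (fun y => G (t, y)) ζ x = planeDeriv G ξ (t, x) := by
  have e : ζ =ᶠ[𝓝 x] fun y => ξ (t, y) := by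
    have : (fun y : ℝ => (t, y)) ⁻¹' Ω ∈ 𝓝 x :=
      (Continuous.prodMk_right t).continuousAt.preimage_mem_nhds (hΩ.mem_nhds hp)
    filter_upwards [this] with y hy using h y hy
  rw [covDeriv_congr e, covDeriv, planeDeriv,
    (hasDerivAt_snd (differentiableAt_of_contDiffOn hΩ hG hp)).deriv,
    (hasDerivAt_snd (differentiableAt_of_contDiffOn hΩ hξ hp)).deriv]

theorem unitTangent_slice (hΩ : IsOpen Ω) (hG : ContDiffOn ℝ ∞ G Ω) {t x : ℝ}
    (hp : (t, x) ∈ Ω) : unitTangent (fun y => G (t, y)) x = planeDeriv G G (t, x) :=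
  covDeriv_slice hΩ hG hG (fun _ _ => rfl) hp

/-- The derivative of the speed in a family of curves. -/
theorem dd_speed (hΩ : IsOpen Ω) (hG : ContDiffOn ℝ ∞ G Ω)
    (h0 : ∀ p ∈ Ω, dd (0, 1) G p ≠ 0) {V : ℝ → E3} {t : ℝ}
    (hV : ∀ y, (t, y) ∈ Ω → dd (1, 0) G (t, y) = V y) {x : ℝ} (hp : (t, x) ∈ Ω) :
    dd (1, 0) (fun q => ‖dd (0, 1) G q‖) (t, x)
      = inner ℝ (unitTangent (fun y => G (t, y)) x) (deriv V x) := by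
  have hd := differentiableAt_of_contDiffOn hΩ (contDiffOn_dd hΩ hG (0, 1)) hp
  have ht := hasDerivAt_snd (differentiableAt_of_contDiffOn hΩ (contDiffOn_dd hΩ hG (1, 0)) hp)
  have e : V =ᶠ[𝓝 x] fun y => dd (1, 0) G (t, y) := by
    have : (fun y : ℝ => (t, y)) ⁻¹' Ω ∈ 𝓝 x :=
      (Continuous.prodMk_right t).continuousAt.preimage_mem_nhds (hΩ.mem_nhds hp)
    filter_upwards [this] with y hy using (hV y hy).symm
  rw [dd_norm hd (h0 _ hp), dd_comm hΩ hG hp, unitTangent_slice hΩ hG hp, planeDeriv, e.deriv_eq,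
    ht.deriv, inner_smul_left]
  rfl

/-- At an instant when the variation preserves the speed, it commutes with covariant
differentiation. -/
theorem dd_planeDeriv (hΩ : IsOpen Ω) (hG : ContDiffOn ℝ ∞ G Ω)
    (h0 : ∀ p ∈ Ω, dd (0, 1) G p ≠ 0) {ξ : ℝ × ℝ → E3} (hξ : ContDiffOn ℝ ∞ ξ Ω)
    {ζ : ℝ → E3} {t x : ℝ} (hp : (t, x) ∈ Ω) (hζ : ∀ y, (t, y) ∈ Ω → dd (1, 0) ξ (t, y) = ζ y)
    (hs : dd (1, 0) (fun q => ‖dd (0, 1) G q‖) (t, x) = 0) :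
    dd (1, 0) (planeDeriv G ξ) (t, x) = covDeriv (fun y => G (t, y)) ζ x := by
  have hn : ContDiffOn ℝ ∞ (fun q => ‖dd (0, 1) G q‖) Ω := (contDiffOn_dd hΩ hG _).norm ℝ h0
  have hnz : ‖dd (0, 1) G (t, x)‖ ≠ 0 := norm_ne_zero_iff.2 (h0 _ hp)
  have hnd := differentiableAt_of_contDiffOn hΩ hn hp
  have hinv : dd (1, 0) (fun q => ‖dd (0, 1) G q‖⁻¹) (t, x) = 0 := by
    refine dd_eq_of_line (hnd.fun_inv hnz) ?_
    have := (hasDerivAt_line hnd (1, 0)).fun_inv (by simpa using hnz)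
    rw [hs] at this
    simpa using this
  rw [covDeriv_slice hΩ hG (contDiffOn_dd hΩ hξ (1, 0)) (fun y hy => (hζ y hy).symm) hp]
  unfold planeDeriv
  rw [dd_smul (hnd.fun_inv hnz) (differentiableAt_of_contDiffOn hΩ (contDiffOn_dd hΩ hξ _) hp),
    hinv, zero_smul, zero_add, dd_comm hΩ hξ hp]

end variation

/-- The first variation of the frame under a speed-preserving field `V`. -/
theorem variation_frame {γ V : ℝ → E3} (hγ : ContDiff ℝ ∞ γ) (h0 : ∀ x, deriv γ x ≠ 0)
    (hV : ContDiff ℝ ∞ V) (hs : ∀ x, inner ℝ (unitTangent γ x) (deriv V x) = (0 : ℝ)) (x : ℝ) :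
    HasDerivAt (fun ε : ℝ => unitTangent (fun y => γ y + ε • V y) x) (covDeriv γ V x) 0 ∧
    HasDerivAt (fun ε : ℝ => meanCurvature (fun y => γ y + ε • V y) x)
      (covDeriv γ (covDeriv γ V) x) 0 ∧
    HasDerivAt (fun ε : ℝ => curvature₁ (fun y => γ y + ε • V y) x)
      (covDeriv γ (covDeriv γ (covDeriv γ V)) x) 0 := by
  set G : ℝ × ℝ → E3 := fun p => γ p.2 + p.1 • V p.2 with hGdef
  have hG' : ContDiff ℝ ∞ G := by fun_prop
  have hcd : ContDiff ℝ ∞ (dd (0, 1) G) :=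
    (hG'.fderiv_right (by simp)).clm_apply contDiff_const
  -- `Ω` contains the line ε = 0 but possibly no strip around it: for small ε ≠ 0 the perturbed
  -- curve may still be singular far out. All formulas are therefore local near `(0, x)`.
  set Ω : Set (ℝ × ℝ) := {p | dd (0, 1) G p ≠ 0} with hΩdef
  have hΩ : IsOpen Ω := isOpen_ne_fun hcd.continuous continuous_const
  have hG : ContDiffOn ℝ ∞ G Ω := hG'.contDiffOn
  have hne : ∀ p ∈ Ω, dd (0, 1) G p ≠ 0 := fun p hp => hp
  have hγ0 : (fun y => G (0, y)) = γ := by ext1 y; simp [hGdef]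
  have hmem : ∀ y, ((0 : ℝ), y) ∈ Ω := by
    intro y
    have := (hasDerivAt_snd (hG'.differentiable (by simp) ((0 : ℝ), y))).deriv
    rw [hγ0] at this
    rw [hΩdef, mem_ofPred_eq, ← this]
    exact h0 y
  have hV0 : ∀ y, dd (1, 0) G (0, y) = V y := by
    intro y
    have h1 := hasDerivAt_fst (hG'.differentiable (by simp) ((0 : ℝ), y))
    have h2 : HasDerivAt (fun r : ℝ => G (r, y)) (V y) 0 := by
      have := ((hasDerivAt_id (0 : ℝ)).smul_const (V y)).const_add (γ y)
      rwa [one_smul] at this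
    exact h1.unique h2
  have hs' : ∀ y, dd (1, 0) (fun q => ‖dd (0, 1) G q‖) (0, y) = 0 := by
    intro y
    rw [dd_speed hΩ hG hne (fun y _ => hV0 y) (hmem y), hγ0, hs]
  have c1 := contDiffOn_planeDeriv hΩ hG hne hG
  have c2 := contDiffOn_planeDeriv hΩ hG hne c1
  have c3 := contDiffOn_planeDeriv hΩ hG hne c2
  -- Each variation is computed along the whole line ε = 0, since the next one differentiates it in
  -- the curve parameter.
  have v1 : ∀ y, dd (1, 0) (planeDeriv G G) (0, y) = covDeriv γ V y := by
    intro y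
    rw [dd_planeDeriv hΩ hG hne hG (hmem y) (fun y _ => hV0 y) (hs' y), hγ0]
  have v2 : ∀ y, dd (1, 0) (planeDeriv G (planeDeriv G G)) (0, y)
      = covDeriv γ (covDeriv γ V) y := by
    intro y
    rw [dd_planeDeriv hΩ hG hne c1 (hmem y) (fun y _ => v1 y) (hs' y), hγ0]
  have v3 : dd (1, 0) (planeDeriv G (planeDeriv G (planeDeriv G G))) (0, x)
      = covDeriv γ (covDeriv γ (covDeriv γ V)) x := by
    rw [dd_planeDeriv hΩ hG hne c2 (hmem x) (fun y _ => v2 y) (hs' x), hγ0]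
  have ev : ∀ᶠ ε : ℝ in 𝓝 0, (ε, x) ∈ Ω :=
    (Continuous.prodMk_left x).continuousAt.preimage_mem_nhds (hΩ.mem_nhds (hmem x))
  have s1 : ∀ ε y, (ε, y) ∈ Ω → unitTangent (fun z => γ z + ε • V z) y
      = planeDeriv G G (ε, y) := fun ε y h => unitTangent_slice hΩ hG h
  have s2 : ∀ ε y, (ε, y) ∈ Ω → meanCurvature (fun z => γ z + ε • V z) y
      = planeDeriv G (planeDeriv G G) (ε, y) :=
    fun ε y h => covDeriv_slice hΩ hG c1 (s1 ε) h
  have s3 : ∀ ε y, (ε, y) ∈ Ω → curvature₁ (fun z => γ z + ε • V z) y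
      = planeDeriv G (planeDeriv G (planeDeriv G G)) (ε, y) :=
    fun ε y h => covDeriv_slice hΩ hG c2 (s2 ε) h
  have d1 := hasDerivAt_fst (differentiableAt_of_contDiffOn hΩ c1 (hmem x))
  have d2 := hasDerivAt_fst (differentiableAt_of_contDiffOn hΩ c2 (hmem x))
  have d3 := hasDerivAt_fst (differentiableAt_of_contDiffOn hΩ c3 (hmem x))
  rw [v1] at d1
  rw [v2] at d2
  rw [v3] at d3
  refine ⟨d1.congr_of_eventuallyEq ?_, d2.congr_of_eventuallyEq ?_, d3.congr_of_eventuallyEq ?_⟩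
  · filter_upwards [ev] with ε hε using s1 ε x hε
  · filter_upwards [ev] with ε hε using s2 ε x hε
  · filter_upwards [ev] with ε hε using s3 ε x hε

/-- The normalized geometric Airy field and the vortex filament field commute. -/
theorem bracketVanishesAt {γ : ℝ → E3} (hγ : ContDiff ℝ ∞ γ) (h0 : ∀ x, deriv γ x ≠ 0) :
    BracketVanishesAt normalizedAiry vfe γ := by
  intro x
  obtain ⟨e1, e2, -⟩ := variation_frame hγ h0 (contDiff_normalizedAiry hγ h0)
    (inner_tangent_deriv_normalizedAiry hγ h0) x
  refine ⟨_, ?_, (e1.cross e2).const_smul (1 / 2 : ℝ)⟩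
  obtain ⟨d1, d2, d3⟩ := variation_frame hγ h0 (contDiff_vfe hγ h0)
    (inner_tangent_deriv_vfe hγ h0) x
  -- The unsimplified form of the field is differentiated: `normalizedAiry_eq` needs a curve
  -- immersed everywhere, which the perturbed curves need not be.
  have hN : ∀ c : ℝ → E3, normalizedAiry c x = -((1 / 8 : ℝ) * inner ℝ (meanCurvature c x)
      (meanCurvature c x)) • unitTangent c x - (1 / 4 : ℝ) • (curvature₁ c x -
        (inner ℝ (unitTangent c x) (curvature₁ c x) : ℝ) • unitTangent c x) := by
    intro c
    rw [real_inner_self_eq_norm_sq]; rfl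
  simp only [hN]
  have D := ((((d2.inner ℝ d2).const_mul (1 / 8)).fun_neg.fun_smul d1).fun_sub
    ((d3.fun_sub ((d1.inner ℝ d3).fun_smul d1)).fun_const_smul (1 / 4 : ℝ)))
  refine D.congr_deriv ?_
  simp only [zero_smul, add_zero]
  rw [covDeriv_covDeriv_normalizedAiry hγ h0, covDeriv_normalizedAiry hγ h0,
    covDeriv_covDeriv_covDeriv_vfe hγ h0, covDeriv_covDeriv_vfe hγ h0, covDeriv_vfe hγ h0]
  have haa := inner_tangent_self h0 x
  have hab := inner_tangent_meanCurvature hγ h0 x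
  have hac := inner_tangent_curvature₁ hγ h0 x
  have had := inner_tangent_curvature₂ hγ h0 x
  have key := bracket_algebra (c := curvature₁ γ x) (e := covDeriv γ (curvature₂ γ) x)
    haa hab had
  beta_reduce
  rw [← key]
  generalize unitTangent γ x = a at *
  generalize meanCurvature γ x = b at *
  generalize curvature₁ γ x = c at *
  generalize curvature₂ γ x = d at *
  generalize covDeriv γ (curvature₂ γ) x = e at *
  rw [real_inner_comm b ((1 / 2 : ℝ) • (cross b c + cross a d)), hac]
  -- The variation of ⟨e₀, H₁⟩ equals that of -|H|²; this reconciles the projected form with the one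
  -- in `bracket_algebra`.
  have k1 : (inner ℝ a ((1 / 2 : ℝ) • ((2 : ℝ) • cross b d + cross a e)) : ℝ)
      + inner ℝ ((1 / 2 : ℝ) • cross a c) c
      = -2 * inner ℝ b ((1 / 2 : ℝ) • (cross b c + cross a d)) := by
    simp [inner_eq_sum]; ring
  rw [k1]
  module

/-! ### Evolution of the speed along a flow -/

theorem IsSolution.hasDerivAt_speed {X : (ℝ → E3) → ℝ → E3} {J : Set ℝ} {γ : ℝ → ℝ → E3}
    (hJ : IsOpen J) (h : IsSolution X J γ) : ∃ f : ℝ × ℝ → ℝ, ContDiffOn ℝ ∞ f (J ×ˢ univ) ∧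
      ∀ t ∈ J, ∀ x, HasDerivAt (fun τ => ‖deriv (γ τ) x‖) (f (t, x)) t ∧
        f (t, x) = inner ℝ (unitTangent (γ t) x) (deriv (X (γ t)) x) := by
  set G : ℝ × ℝ → E3 := fun z => γ z.1 z.2
  have hΩ : IsOpen (J ×ˢ (univ : Set ℝ)) := hJ.prod isOpen_univ
  have hG : ContDiffOn ℝ ∞ G (J ×ˢ univ) := h.smooth
  have hsl : ∀ t ∈ J, ∀ x, deriv (γ t) x = dd (0, 1) G (t, x) := fun t ht x =>
    (hasDerivAt_snd (f := G) (differentiableAt_of_contDiffOn hΩ hG ⟨ht, mem_univ x⟩)).deriv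
  have hne : ∀ p ∈ J ×ˢ (univ : Set ℝ), dd (0, 1) G p ≠ 0 := by
    rintro ⟨t, x⟩ ⟨ht, -⟩
    rw [← hsl t ht x]
    exact h.immersed t ht x
  have hn : ContDiffOn ℝ ∞ (fun q => ‖dd (0, 1) G q‖) (J ×ˢ univ) :=
    (contDiffOn_dd hΩ hG _).norm ℝ hne
  refine ⟨_, contDiffOn_dd hΩ hn (1, 0), fun t ht x => ⟨?_, ?_⟩⟩
  · refine (hasDerivAt_fst (differentiableAt_of_contDiffOn hΩ hn
      ⟨ht, mem_univ x⟩)).congr_of_eventuallyEq ?_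
    filter_upwards [hJ.mem_nhds ht] with τ hτ
    rw [hsl τ hτ]
  · refine dd_speed hΩ hG hne (fun y hy => ?_) ⟨ht, mem_univ x⟩
    exact (hasDerivAt_fst (differentiableAt_of_contDiffOn hΩ hG hy)).unique (h.eqn t ht y)

theorem eq_of_hasDerivAt_zero {J : Set ℝ} (hJ' : J.OrdConnected) {f : ℝ → ℝ}
    (h : ∀ t ∈ J, HasDerivAt f 0 t) {t₁ t₂ : ℝ} (h₁ : t₁ ∈ J) (h₂ : t₂ ∈ J) : f t₁ = f t₂ := by
  have hc : Convex ℝ J := hJ'.convex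
  have := hc.norm_image_sub_le_of_norm_hasDerivWithin_le (C := 0)
    (fun t ht => (h t ht).hasDerivWithinAt) (by simp) h₁ h₂
  simp at this
  linarith [sub_eq_zero.1 this]

/-- A flow whose field is infinitesimally speed preserving preserves the speed. -/
theorem IsSolution.norm_deriv_eq {X : (ℝ → E3) → ℝ → E3} {J : Set ℝ} {γ : ℝ → ℝ → E3}
    (hX : ∀ c : ℝ → E3, ContDiff ℝ ∞ c → (∀ x, deriv c x ≠ 0) →
      ∀ x, inner ℝ (unitTangent c x) (deriv (X c) x) = (0 : ℝ))
    (hJ : IsOpen J) (hJ' : J.OrdConnected) (h : IsSolution X J γ) :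
    ∀ t₁ ∈ J, ∀ t₂ ∈ J, ∀ x, ‖deriv (γ t₁) x‖ = ‖deriv (γ t₂) x‖ := by
  obtain ⟨f, -, hf⟩ := h.hasDerivAt_speed hJ
  intro t₁ h₁ t₂ h₂ x
  refine eq_of_hasDerivAt_zero (f := fun t => ‖deriv (γ t) x‖) hJ' (fun t ht => ?_) h₁ h₂
  have hc : ContDiff ℝ ∞ (γ t) :=
    h.smooth.comp_contDiff (f := fun x => (t, x)) (contDiff_prodMk_right t)
      (fun x => ⟨ht, mem_univ x⟩)
  have := (hf t ht x).1
  rwa [(hf t ht x).2, hX _ hc (h.immersed t ht) x] at this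

/-! ### Integrals depending on time, arc-length -/

theorem hasDerivAt_integral_param {J : Set ℝ} (hJ : IsOpen J) {f f' : ℝ × ℝ → ℝ}
    (hf : ContinuousOn f (J ×ˢ univ)) (hf' : ContinuousOn f' (J ×ˢ univ))
    (h : ∀ t ∈ J, ∀ x, HasDerivAt (fun τ => f (τ, x)) (f' (t, x)) t) (a b : ℝ) {t : ℝ}
    (ht : t ∈ J) :
    HasDerivAt (fun τ => ∫ x in a..b, f (τ, x)) (∫ x in a..b, f' (t, x)) t := by
  obtain ⟨r, hr, hrJ⟩ := Metric.nhds_basis_closedBall.mem_iff.1 (hJ.mem_nhds ht)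
  have slice : ∀ {g : ℝ × ℝ → ℝ}, ContinuousOn g (J ×ˢ univ) → ∀ τ ∈ J,
      Continuous fun x => g (τ, x) := fun hg τ hτ =>
    hg.comp_continuous (Continuous.prodMk_right τ) (fun x => ⟨hτ, mem_univ x⟩)
  obtain ⟨C, hC⟩ := ((isCompact_closedBall t r).prod (isCompact_uIcc (a := a) (b := b))
    ).exists_bound_of_continuousOn (hf'.mono (prod_mono hrJ (subset_univ _)))
  refine (intervalIntegral.hasDerivAt_integral_of_dominated_loc_of_deriv_le
    (F := fun τ x => f (τ, x)) (F' := fun τ x => f' (τ, x)) (s := Metric.closedBall t r)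
    (bound := fun _ => C)
    (Metric.closedBall_mem_nhds t hr) ?_ ?_ ?_ ?_ ?_ ?_).2
  · filter_upwards [hJ.mem_nhds ht] with τ hτ using (slice hf τ hτ).aestronglyMeasurable
  · exact (slice hf t ht).intervalIntegrable _ _
  · exact (slice hf' t ht).aestronglyMeasurable
  · exact Eventually.of_forall fun x hx τ hτ => hC (τ, x) ⟨hτ, uIoc_subset_uIcc hx⟩
  · exact intervalIntegrable_const
  · exact Eventually.of_forall fun x _ τ hτ => h τ (hrJ hτ) x

section airy

variable {J : Set ℝ} {γ : ℝ → ℝ → E3}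

theorem IsSolution.contDiff {X : (ℝ → E3) → ℝ → E3} (h : IsSolution X J γ) {t : ℝ} (ht : t ∈ J) :
    ContDiff ℝ ∞ (γ t) :=
  h.smooth.comp_contDiff (f := fun x => (t, x)) (contDiff_prodMk_right t)
    (fun x => ⟨ht, mem_univ x⟩)

theorem IsSolution.continuousOn_speed {X : (ℝ → E3) → ℝ → E3} (hJ : IsOpen J)
    (h : IsSolution X J γ) : ContinuousOn (fun p : ℝ × ℝ => ‖deriv (γ p.1) p.2‖) (J ×ˢ univ) := by
  have hΩ : IsOpen (J ×ˢ (univ : Set ℝ)) := hJ.prod isOpen_univ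
  refine ((contDiffOn_dd hΩ h.smooth (0, 1)).continuousOn.norm).congr ?_
  rintro ⟨t, x⟩ hp
  exact congrArg norm (hasDerivAt_snd (f := fun z : ℝ × ℝ => γ z.1 z.2)
    (differentiableAt_of_contDiffOn hΩ h.smooth hp)).deriv

/-- The rate of change of arc-length along the geometric Airy flow. -/
theorem hasDerivAt_arcLength (hJ : IsOpen J) (h : IsSolution airy J γ) (a b : ℝ) {t : ℝ}
    (ht : t ∈ J) : HasDerivAt (fun τ => arcLength (γ τ) a b)
      ((1 / 8 : ℝ) * ‖meanCurvature (γ t) b‖ ^ 2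
        - (1 / 8 : ℝ) * ‖meanCurvature (γ t) a‖ ^ 2) t := by
  obtain ⟨f, hf, hfd⟩ := h.hasDerivAt_speed hJ
  have key := hasDerivAt_integral_param hJ (f := fun p => ‖deriv (γ p.1) p.2‖)
    (h.continuousOn_speed hJ) hf.continuousOn (fun t ht x => (hfd t ht x).1) a b ht
  have hc := h.contDiff ht
  have hi := h.immersed t ht
  have hH : ContDiff ℝ ∞ (fun y => (1 / 8 : ℝ) * ‖meanCurvature (γ t) y‖ ^ 2) :=
    contDiff_const.mul ((contDiff_meanCurvature hc hi).norm_sq ℝ)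
  rw [← intervalIntegral.integral_deriv_eq_sub
    (f := fun y => (1 / 8 : ℝ) * ‖meanCurvature (γ t) y‖ ^ 2)
    (fun x _ => hH.differentiable (by simp) x)
    ((hH.continuous_deriv (by simp)).intervalIntegrable _ _)]
  refine key.congr_deriv (intervalIntegral.integral_congr fun x _ => ?_)
  simp only [(hfd t ht x).2, inner_tangent_deriv_airy hc hi]

/-- The curvature inherits the period, so the boundary terms at 0 and `L` cancel. -/
theorem airy_arcLength_periodic (hJ : IsOpen J) (hJ' : J.OrdConnected) (h : IsSolution airy J γ)
    {L : ℝ} (hL : ∀ t ∈ J, ∀ x, γ t (x + L) = γ t x) :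
    ∀ t₁ ∈ J, ∀ t₂ ∈ J, arcLength (γ t₁) 0 L = arcLength (γ t₂) 0 L := by
  intro t₁ h₁ t₂ h₂
  refine eq_of_hasDerivAt_zero (f := fun t => arcLength (γ t) 0 L) hJ' (fun t ht => ?_) h₁ h₂
  have p0 : ∀ {E : Type} [NormedAddCommGroup E] [NormedSpace ℝ E] {f : ℝ → E},
      (∀ x, f (x + L) = f x) → ∀ x, deriv f (x + L) = deriv f x := by
    intro E _ _ f hf x
    rw [← deriv_comp_add_const]
    simp only [hf]
  have p1 := p0 (hL t ht)
  have p2 : ∀ x, unitTangent (γ t) (x + L) = unitTangent (γ t) x := by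
    intro x; rw [unitTangent, p1, unitTangent]
  have p3 : meanCurvature (γ t) (0 + L) = meanCurvature (γ t) 0 := by
    rw [meanCurvature, covDeriv, covDeriv, p0 p2, p1]
  have := hasDerivAt_arcLength hJ h 0 L ht
  rwa [← zero_add L, p3, zero_add, sub_self] at this

/-- The rate of change is the boundary term (|H(b)|² - |H(a)|²)/8, uniformly small on the compact
time interval between `t₁` and `t₂`; the mean value inequality integrates it. -/
theorem airy_arcLength_sub_tendsto (hJ : IsOpen J) (hJ' : J.OrdConnected)
    (h : IsSolution airy J γ)
    (hH : ∀ K : Set ℝ, IsCompact K → K ⊆ J →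
      TendstoUniformlyOn (fun (x t : ℝ) => meanCurvature (γ t) x) (fun _ => 0) (cocompact ℝ) K)
    {t₁ t₂ : ℝ} (h₁ : t₁ ∈ J) (h₂ : t₂ ∈ J) :
    Tendsto (fun p : ℝ × ℝ => arcLength (γ t₁) p.1 p.2 - arcLength (γ t₂) p.1 p.2)
      (atBot ×ˢ atTop) (𝓝 0) := by
  have hK : uIcc t₁ t₂ ⊆ J := hJ'.uIcc_subset h₁ h₂
  rw [Metric.tendsto_nhds]
  intro ε hε
  -- The bound δ ≤ 1 turns |H| < δ into |H|² ≤ δ; the quotient makes δ(1 + |t₁ - t₂|) ≤ ε. The rate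
  -- is then at most δ/8, and δ/2 is a generous constant.
  set δ : ℝ := min 1 (ε / (1 + |t₁ - t₂|)) with hδ
  have hδ0 : 0 < δ := by positivity
  have hu := Metric.tendstoUniformlyOn_iff.1 (hH _ isCompact_uIcc hK) δ hδ0
  have hb := hu.filter_mono atBot_le_cocompact
  have ht := hu.filter_mono atTop_le_cocompact
  filter_upwards [hb.prod_mk ht] with p hp
  obtain ⟨ha, hb⟩ := hp
  have hsq : ∀ x, (∀ t ∈ uIcc t₁ t₂, dist 0 (meanCurvature (γ t) x) < δ) → ∀ t ∈ uIcc t₁ t₂,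
      ‖meanCurvature (γ t) x‖ ^ 2 ≤ δ := by
    intro x hx t ht
    have h1 := hx t ht
    rw [dist_zero_left] at h1
    have h2 : δ ≤ 1 := min_le_left _ _
    nlinarith [norm_nonneg (meanCurvature (γ t) x)]
  have := (convex_uIcc t₁ t₂).norm_image_sub_le_of_norm_hasDerivWithin_le (C := δ / 2)
    (fun t ht => (hasDerivAt_arcLength hJ h p.1 p.2 (hK ht)).hasDerivWithinAt)
    (fun t ht => by
      have i1 := hsq _ ha t ht
      have i2 := hsq _ hb t ht
      have i3 := sq_nonneg ‖meanCurvature (γ t) p.1‖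
      have i4 := sq_nonneg ‖meanCurvature (γ t) p.2‖
      rw [Real.norm_eq_abs, abs_le]
      constructor <;> linarith) right_mem_uIcc left_mem_uIcc
  rw [dist_zero_right]
  refine this.trans_lt ?_
  have h3 : δ * (1 + |t₁ - t₂|) ≤ ε := by
    rw [← le_div_iff₀ (by positivity)]
    exact min_le_right _ _
  rw [Real.norm_eq_abs]
  nlinarith [abs_nonneg (t₁ - t₂)]

theorem tendsto_arcLength_total {X : (ℝ → E3) → ℝ → E3} (h : IsSolution X J γ) {t : ℝ}
    (ht : t ∈ J) : Tendsto (fun n : ℕ => ENNReal.ofReal (arcLength (γ t) (-n) n)) atTop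
      (𝓝 (totalArcLength (γ t))) := by
  have hc : Continuous fun x => ‖deriv (γ t) x‖ :=
    ((h.contDiff ht).continuous_deriv (by simp)).norm
  have hcov : AECover volume atTop (fun n : ℕ => Ioc (-(n : ℝ)) n) :=
    aecover_Ioc (tendsto_neg_atTop_atBot.comp tendsto_natCast_atTop_atTop)
      tendsto_natCast_atTop_atTop
  have := hcov.lintegral_tendsto_of_countably_generated
    (f := fun x => ENNReal.ofReal ‖deriv (γ t) x‖) hc.measurable.ennreal_ofReal.aemeasurable
  refine this.congr fun n => ?_
  have hn : (-(n : ℝ)) ≤ n := by linarith [Nat.cast_nonneg (α := ℝ) n]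
  rw [arcLength, intervalIntegral.integral_of_le hn, ofReal_integral_eq_lintegral_ofReal]
  · exact hc.integrableOn_Ioc
  · exact Eventually.of_forall fun x => norm_nonneg _

/-- Lengths may be infinite, so the limit is taken in [0, ∞]: on [-n, n] the two lengths differ by a
null sequence, which gives one inequality, and exchanging the times gives the other. -/
theorem airy_totalArcLength_eq (hJ : IsOpen J) (hJ' : J.OrdConnected)
    (h : IsSolution airy J γ)
    (hH : ∀ K : Set ℝ, IsCompact K → K ⊆ J →
      TendstoUniformlyOn (fun (x t : ℝ) => meanCurvature (γ t) x) (fun _ => 0) (cocompact ℝ) K)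
    {t₁ t₂ : ℝ} (h₁ : t₁ ∈ J) (h₂ : t₂ ∈ J) :
    totalArcLength (γ t₁) = totalArcLength (γ t₂) := by
  have hle : ∀ t₁ ∈ J, ∀ t₂ ∈ J, totalArcLength (γ t₁) ≤ totalArcLength (γ t₂) := by
    intro t₁ h₁ t₂ h₂
    have hd := (airy_arcLength_sub_tendsto hJ hJ' h hH h₁ h₂).comp
      ((tendsto_neg_atTop_atBot.comp tendsto_natCast_atTop_atTop).prodMk
        (tendsto_natCast_atTop_atTop (R := ℝ)))
    have hr := (tendsto_arcLength_total h h₂).add (ENNReal.tendsto_ofReal hd)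
    rw [ENNReal.ofReal_zero, add_zero] at hr
    refine le_of_tendsto_of_tendsto' (tendsto_arcLength_total h h₁) hr fun n => ?_
    refine le_trans (le_of_eq ?_) ENNReal.ofReal_add_le
    congr 1
    simp
  exact le_antisymm (hle _ h₁ _ h₂) (hle _ h₂ _ h₁)

end airy

/-! ### An energy estimate -/

/-- A density `e ≥ 0` with `e_t = B_x + r`, `|r| ≤ C e`, zero at the initial time, vanishes, if
`B` has small increments over arbitrarily long intervals. -/
theorem energy_eq_zero {J : Set ℝ} (hJ : IsOpen J) (hJ' : J.OrdConnected) {t₀ t₁ : ℝ}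
    (h₀ : t₀ ∈ J) (h₁ : t₁ ∈ J) {e e' B r : ℝ × ℝ → ℝ}
    (he : ContinuousOn e (J ×ˢ univ)) (he' : ContinuousOn e' (J ×ˢ univ))
    (hr : ContinuousOn r (J ×ˢ univ))
    (hpos : ∀ t ∈ J, ∀ x, 0 ≤ e (t, x)) (hinit : ∀ x, e (t₀, x) = 0)
    (ht : ∀ t ∈ J, ∀ x, HasDerivAt (fun τ => e (τ, x)) (e' (t, x)) t)
    (hB : ∀ t ∈ J, ∀ x, HasDerivAt (fun y => B (t, y)) (e' (t, x) - r (t, x)) x)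
    {C : ℝ} (hrC : ∀ t ∈ uIcc t₀ t₁, ∀ x, |r (t, x)| ≤ C * e (t, x))
    (hBd : ∀ ε > 0, ∀ M : ℝ, ∃ a b, a < -M ∧ M < b ∧
      ∀ t ∈ uIcc t₀ t₁, |B (t, b) - B (t, a)| ≤ ε) (x : ℝ) : e (t₁, x) = 0 := by
  have hK : uIcc t₀ t₁ ⊆ J := hJ'.uIcc_subset h₀ h₁
  have slice : ∀ {g : ℝ × ℝ → ℝ}, ContinuousOn g (J ×ˢ univ) → ∀ τ ∈ J,
      Continuous fun x => g (τ, x) := fun hg τ hτ =>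
    hg.comp_continuous (Continuous.prodMk_right τ) (fun x => ⟨hτ, mem_univ x⟩)
  -- the Gronwall bound on one interval
  have main : ∀ ε > 0, ∀ a b, a ≤ b → (∀ t ∈ uIcc t₀ t₁, |B (t, b) - B (t, a)| ≤ ε) →
      ∫ y in a..b, e (t₁, y) ≤ gronwallBound 0 (|t₁ - t₀| * C) (|t₁ - t₀| * ε) 1 := by
    intro ε hε a b hab hBε
    set f : ℝ → ℝ := fun t => ∫ y in a..b, e (t, y) with hf
    have hfd : ∀ t ∈ J, HasDerivAt f (∫ y in a..b, e' (t, y)) t := fun t ht' =>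
      hasDerivAt_integral_param hJ he he' ht a b ht'
    have hfpos : ∀ t ∈ J, 0 ≤ f t := fun t ht' =>
      intervalIntegral.integral_nonneg hab fun y _ => hpos t ht' y
    have hbd : ∀ t ∈ uIcc t₀ t₁, |∫ y in a..b, e' (t, y)| ≤ C * f t + ε := by
      intro t ht'
      have htJ := hK ht'
      have hc' := slice he' t htJ
      have hcr := slice hr t htJ
      have i1 : ∫ y in a..b, (e' (t, y) - r (t, y)) = B (t, b) - B (t, a) :=
        intervalIntegral.integral_eq_sub_of_hasDerivAt (f := fun y => B (t, y))
          (fun y _ => hB t htJ y) ((hc'.sub hcr).intervalIntegrable _ _)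
      rw [intervalIntegral.integral_sub (hc'.intervalIntegrable _ _)
        (hcr.intervalIntegrable _ _)] at i1
      have i2 : |∫ y in a..b, r (t, y)| ≤ C * f t := by
        rw [hf, ← intervalIntegral.integral_const_mul]
        refine (intervalIntegral.abs_integral_le_integral_abs hab).trans ?_
        exact intervalIntegral.integral_mono_on hab (hcr.abs.intervalIntegrable _ _)
          (((slice he t htJ).const_mul C).intervalIntegrable _ _) (fun y _ => hrC t ht' y)
      have i3 := hBε t ht'
      rw [← i1] at i3
      rw [abs_le] at *
      constructor <;> linarith [i2.1, i2.2, i3.1, i3.2]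
    -- An affine path from `t₀` to `t₁` over [0, 1] treats both time directions at once, at the
    -- price of the factor |t₁ - t₀| in the constants.
    set φ : ℝ → ℝ := fun σ => t₀ + σ * (t₁ - t₀)
    have hφ : ∀ σ ∈ Icc (0 : ℝ) 1, φ σ ∈ uIcc t₀ t₁ := by
      intro σ hσ
      rw [← segment_eq_uIcc]
      exact ⟨1 - σ, σ, by linarith [hσ.2], hσ.1, by ring, by simp only [smul_eq_mul, φ]; ring⟩
    have hφd : ∀ σ, HasDerivAt φ (t₁ - t₀) σ := fun σ => by
      have := ((hasDerivAt_id σ).mul_const (t₁ - t₀)).const_add t₀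
      rwa [one_mul] at this
    have hg : ∀ σ ∈ Icc (0 : ℝ) 1, HasDerivAt (fun σ => f (φ σ))
        ((∫ y in a..b, e' (φ σ, y)) * (t₁ - t₀)) σ := fun σ hσ =>
      (hfd _ (hK (hφ σ hσ))).comp σ (hφd σ)
    have G := norm_le_gronwallBound_of_norm_deriv_right_le (δ := 0) (K := |t₁ - t₀| * C)
      (ε := |t₁ - t₀| * ε) (a := 0) (b := 1)
      (fun σ hσ => (hg σ hσ).continuousAt.continuousWithinAt)
      (fun σ hσ => (hg σ (Ico_subset_Icc_self hσ)).hasDerivWithinAt)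
      (by simp [φ, hf, hinit]) (fun σ hσ => by
        have hσ' := hφ σ (Ico_subset_Icc_self hσ)
        rw [Real.norm_eq_abs, abs_mul, Real.norm_eq_abs, abs_of_nonneg (hfpos _ (hK hσ')),
          mul_comm]
        have := mul_le_mul_of_nonneg_left (hbd _ hσ') (abs_nonneg (t₁ - t₀))
        linarith) 1 ⟨zero_le_one, le_rfl⟩
    have e1 : φ 1 = t₁ := by simp [φ]
    rw [sub_zero, e1] at G
    exact (le_abs_self _).trans G
  -- the integral over every fixed interval is zero
  have hint : ∀ M > 0, ∫ y in (-M)..M, e (t₁, y) ≤ 0 := by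
    intro M hM
    -- The initial energy is zero, so the bound depends on the interval only through ε and tends to
    -- 0 with it. As the density is nonnegative, enlarging [-M, M] to [a, b] loses nothing.
    have hlim : Tendsto (fun ε : ℝ => gronwallBound 0 (|t₁ - t₀| * C) (|t₁ - t₀| * ε) 1)
        (𝓝[>] 0) (𝓝 0) := by
      have hc : Continuous fun ε : ℝ => gronwallBound 0 (|t₁ - t₀| * C) (|t₁ - t₀| * ε) 1 :=
        (gronwallBound_continuous_ε 0 (|t₁ - t₀| * C) 1).comp (continuous_const_mul _)
      have := hc.tendsto 0
      rw [mul_zero, gronwallBound_ε0_δ0] at this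
      exact this.mono_left nhdsWithin_le_nhds
    refine ge_of_tendsto hlim ?_
    filter_upwards [self_mem_nhdsWithin] with ε hε
    obtain ⟨a, b, ha, hb, hab⟩ := hBd ε hε M
    refine le_trans ?_ (main ε hε a b (by linarith) hab)
    have hc := slice he t₁ h₁
    exact intervalIntegral.integral_mono_interval ha.le (by linarith) hb.le
      (Eventually.of_forall fun y => hpos t₁ h₁ y) (hc.intervalIntegrable _ _)
  by_contra hne
  have hc := slice he t₁ h₁
  have hM : (0 : ℝ) < |x| + 1 := by positivity
  have : 0 < ∫ y in (-(|x| + 1))..(|x| + 1), e (t₁, y) := by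
    refine intervalIntegral.integral_pos (by linarith) hc.continuousOn (fun y _ => hpos t₁ h₁ y)
      ⟨x, ⟨by linarith [neg_abs_le x], by linarith [le_abs_self x]⟩, ?_⟩
    exact lt_of_le_of_ne (hpos t₁ h₁ x) (Ne.symm hne)
  exact absurd (hint _ hM) (not_le.2 this)

/-! ### Two-parameter families of curves parametrized by arc-length -/

section partials

variable {E : Type*} [NormedAddCommGroup E] [NormedSpace ℝ E] {f : ℝ × ℝ × ℝ → E} {s t x : ℝ}

/-- The partial derivative in the first time. -/
abbrev dS (f : ℝ × ℝ × ℝ → E) : ℝ × ℝ × ℝ → E := dd (1, 0, 0) f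

/-- The partial derivative in the second time. -/
abbrev dT (f : ℝ × ℝ × ℝ → E) : ℝ × ℝ × ℝ → E := dd (0, 1, 0) f

/-- The partial derivative in the curve parameter. -/
abbrev dX (f : ℝ × ℝ × ℝ → E) : ℝ × ℝ × ℝ → E := dd (0, 0, 1) f

theorem hasDerivAt_dS (hf : DifferentiableAt ℝ f (s, t, x)) :
    HasDerivAt (fun r => f (r, t, x)) (dS f (s, t, x)) s :=
  hf.hasFDerivAt.comp_hasDerivAt s
    ((hasDerivAt_id s).prodMk ((hasDerivAt_const s t).prodMk (hasDerivAt_const s x)))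

theorem hasDerivAt_dT (hf : DifferentiableAt ℝ f (s, t, x)) :
    HasDerivAt (fun r => f (s, r, x)) (dT f (s, t, x)) t :=
  hf.hasFDerivAt.comp_hasDerivAt t
    ((hasDerivAt_const t s).prodMk ((hasDerivAt_id t).prodMk (hasDerivAt_const t x)))

theorem hasDerivAt_dX (hf : DifferentiableAt ℝ f (s, t, x)) :
    HasDerivAt (fun r => f (s, t, r)) (dX f (s, t, x)) x :=
  hf.hasFDerivAt.comp_hasDerivAt x
    ((hasDerivAt_const x s).prodMk ((hasDerivAt_const x t).prodMk (hasDerivAt_id x)))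

/-- The iterated derivatives in the curve parameter. -/
def jet (f : ℝ × ℝ × ℝ → E) : ℕ → ℝ × ℝ × ℝ → E
  | 0 => f
  | n + 1 => dX (jet f n)

variable {Ω : Set (ℝ × ℝ × ℝ)}

theorem contDiffOn_jet (hΩ : IsOpen Ω) (hf : ContDiffOn ℝ ∞ f Ω) :
    ∀ n, ContDiffOn ℝ ∞ (jet f n) Ω
  | 0 => hf
  | n + 1 => contDiffOn_dd hΩ (contDiffOn_jet hΩ hf n) _

theorem dd_jet (hΩ : IsOpen Ω) (hf : ContDiffOn ℝ ∞ f Ω) (v : ℝ × ℝ × ℝ) :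
    ∀ n, ∀ p ∈ Ω, dd v (jet f n) p = jet (dd v f) n p
  | 0 => fun _ _ => rfl
  | n + 1 => fun p hp => by
    change dd v (dX (jet f n)) p = dX (jet (dd v f) n) p
    rw [dX, dd_comm hΩ (contDiffOn_jet hΩ hf n) hp]
    exact dd_congr hΩ (dd_jet hΩ hf v n) _ p hp

theorem jet_congr (hΩ : IsOpen Ω) {g : ℝ × ℝ × ℝ → E} (h : ∀ p ∈ Ω, f p = g p) :
    ∀ n, ∀ p ∈ Ω, jet f n p = jet g n p
  | 0 => h
  | n + 1 => dd_congr hΩ (jet_congr hΩ h n) _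

theorem jet_sub (hΩ : IsOpen Ω) {g : ℝ × ℝ × ℝ → E} (hf : ContDiffOn ℝ ∞ f Ω)
    (hg : ContDiffOn ℝ ∞ g Ω) :
    ∀ n, ∀ p ∈ Ω, jet (fun q => f q - g q) n p = jet f n p - jet g n p
  | 0 => fun _ _ => rfl
  | n + 1 => fun p hp => by
    change dX (jet (fun q => f q - g q) n) p = _
    rw [dX, dd_congr hΩ (jet_sub hΩ hf hg n) _ p hp,
      dd_sub (differentiableAt_of_contDiffOn hΩ (contDiffOn_jet hΩ hf n) hp)
        (differentiableAt_of_contDiffOn hΩ (contDiffOn_jet hΩ hg n) hp)]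
    rfl

theorem jet_add_one (n : ℕ) : jet f (n + 1) = dX (jet f n) := rfl

end partials

/-- The normalized geometric Airy field along a family of curves parametrized by arc-length. -/
def airyField (F : ℝ × ℝ × ℝ → E3) (p : ℝ × ℝ × ℝ) : E3 := -((1 / 4 : ℝ) • jet F 3 p)
  - ((3 / 8 : ℝ) * inner ℝ (jet F 2 p) (jet F 2 p)) • jet F 1 p

/-- The vortex filament field along a family of curves parametrized by arc-length. -/
def vfeField (F : ℝ × ℝ × ℝ → E3) (p : ℝ × ℝ × ℝ) : E3 :=
  (1 / 2 : ℝ) • cross (jet F 1 p) (jet F 2 p)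

/-- A smooth family of curves parametrized by arc-length. -/
structure UnitFamily (I J : Set ℝ) (F : ℝ × ℝ × ℝ → E3) : Prop where
  openI : IsOpen I
  openJ : IsOpen J
  smooth : ContDiffOn ℝ ∞ F (I ×ˢ J ×ˢ univ)
  unit : ∀ s ∈ I, ∀ t ∈ J, ∀ x, ‖deriv (fun y => F (s, t, y)) x‖ = 1

namespace UnitFamily

variable {I J : Set ℝ} {F : ℝ × ℝ × ℝ → E3} (U : UnitFamily I J F)
include U

theorem isOpen : IsOpen (I ×ˢ J ×ˢ (univ : Set ℝ)) := U.openI.prod (U.openJ.prod isOpen_univ)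

theorem jet_smooth (n : ℕ) : ContDiffOn ℝ ∞ (jet F n) (I ×ˢ J ×ˢ univ) :=
  contDiffOn_jet U.isOpen U.smooth n

theorem diffAt {E : Type*} [NormedAddCommGroup E] [NormedSpace ℝ E] {f : ℝ × ℝ × ℝ → E}
    (hf : ContDiffOn ℝ ∞ f (I ×ˢ J ×ˢ univ)) {p : ℝ × ℝ × ℝ} (hp : p ∈ I ×ˢ J ×ˢ (univ : Set ℝ)) :
    DifferentiableAt ℝ f p := differentiableAt_of_contDiffOn U.isOpen hf hp

theorem diffAt_jet (n : ℕ) {p : ℝ × ℝ × ℝ} (hp : p ∈ I ×ˢ J ×ˢ (univ : Set ℝ)) :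
    DifferentiableAt ℝ (jet F n) p := U.diffAt (U.jet_smooth n) hp

theorem airyField_smooth : ContDiffOn ℝ ∞ (airyField F) (I ×ˢ J ×ˢ univ) :=
  (((U.jet_smooth 3).const_smul (1 / 4 : ℝ)).neg).sub
    ((contDiffOn_const.mul ((U.jet_smooth 2).inner ℝ (U.jet_smooth 2))).smul (U.jet_smooth 1))

theorem vfeField_smooth : ContDiffOn ℝ ∞ (vfeField F) (I ×ˢ J ×ˢ univ) :=
  ((U.jet_smooth 1).cross (U.jet_smooth 2)).const_smul (1 / 2 : ℝ)

/-- The variation of the Airy field. -/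
theorem dd_airyField (v : ℝ × ℝ × ℝ) : ∀ p ∈ I ×ˢ J ×ˢ (univ : Set ℝ), dd v (airyField F) p =
    -((1 / 4 : ℝ) • jet (dd v F) 3 p)
      - ((3 / 8 : ℝ) * (2 * inner ℝ (jet F 2 p) (jet (dd v F) 2 p))) • jet F 1 p
      - ((3 / 8 : ℝ) * inner ℝ (jet F 2 p) (jet F 2 p)) • jet (dd v F) 1 p := by
  intro p hp
  have d1 := U.diffAt_jet 1 hp
  have d2 := U.diffAt_jet 2 hp
  have d3 := U.diffAt_jet 3 hp
  unfold airyField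
  rw [dd_sub (d3.fun_const_smul _).fun_neg (((d2.inner ℝ d2).const_mul _).fun_smul d1),
    dd_neg (d3.fun_const_smul _), dd_const_smul d3, dd_smul ((d2.inner ℝ d2).const_mul _) d1,
    dd_const_mul (d2.inner ℝ d2), dd_inner d2 d2]
  simp only [dd_jet U.isOpen U.smooth v _ p hp]
  rw [real_inner_comm (jet F 2 p) (jet (dd v F) 2 p)]
  module

/-- The variation of the vortex filament field. -/
theorem dd_vfeField (v : ℝ × ℝ × ℝ) : ∀ p ∈ I ×ˢ J ×ˢ (univ : Set ℝ), dd v (vfeField F) p =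
    (1 / 2 : ℝ) • (cross (jet (dd v F) 1 p) (jet F 2 p)
      + cross (jet F 1 p) (jet (dd v F) 2 p)) := by
  intro p hp
  have d1 := U.diffAt_jet 1 hp
  have d2 := U.diffAt_jet 2 hp
  have := U.diffAt ((U.jet_smooth 1).cross (U.jet_smooth 2)) hp
  unfold vfeField
  rw [dd_const_smul this, dd_cross d1 d2]
  simp only [dd_jet U.isOpen U.smooth v _ p hp]

section slice

variable {s t : ℝ} (hs : s ∈ I) (ht : t ∈ J)
include hs ht

omit U in
theorem slice_contDiff {E : Type*} [NormedAddCommGroup E] [NormedSpace ℝ E]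
    {f : ℝ × ℝ × ℝ → E} (hf : ContDiffOn ℝ ∞ f (I ×ˢ J ×ˢ univ)) :
    ContDiff ℝ ∞ (fun y => f (s, t, y)) :=
  hf.comp_contDiff (f := fun y => (s, t, y)) (by fun_prop) (fun _ => ⟨hs, ht, mem_univ _⟩)

theorem slice_immersed (x : ℝ) : deriv (fun y => F (s, t, y)) x ≠ 0 := by
  rw [← norm_ne_zero_iff, U.unit s hs t ht x]; exact one_ne_zero

/-- At unit speed the covariant derivative is ∂_x. This converts the formulas for a single immersed
curve into identities between jets of `F`. -/
theorem covDeriv_slice {ξ : ℝ × ℝ × ℝ → E3} (hξ : ContDiffOn ℝ ∞ ξ (I ×ˢ J ×ˢ univ)) :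
    covDeriv (fun y => F (s, t, y)) (fun y => ξ (s, t, y)) = fun y => dX ξ (s, t, y) := by
  ext1 x
  rw [covDeriv, U.unit s hs t ht, inv_one, one_smul]
  exact (hasDerivAt_dX (U.diffAt hξ ⟨hs, ht, mem_univ x⟩)).deriv

theorem unitTangent_eq : unitTangent (fun y => F (s, t, y)) = fun y => jet F 1 (s, t, y) :=
  U.covDeriv_slice hs ht U.smooth

theorem meanCurvature_eq : meanCurvature (fun y => F (s, t, y)) = fun y => jet F 2 (s, t, y) := by
  rw [meanCurvature, U.unitTangent_eq hs ht]
  exact U.covDeriv_slice hs ht (U.jet_smooth 1)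

theorem curvature₁_eq : curvature₁ (fun y => F (s, t, y)) = fun y => jet F 3 (s, t, y) := by
  rw [curvature₁, U.meanCurvature_eq hs ht]
  exact U.covDeriv_slice hs ht (U.jet_smooth 2)

theorem curvature₂_eq : curvature₂ (fun y => F (s, t, y)) = fun y => jet F 4 (s, t, y) := by
  rw [curvature₂, U.curvature₁_eq hs ht]
  exact U.covDeriv_slice hs ht (U.jet_smooth 3)

theorem covDeriv_curvature₂_eq : covDeriv (fun y => F (s, t, y)) (curvature₂ (fun y => F (s, t, y)))
    = fun y => jet F 5 (s, t, y) := by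
  rw [U.curvature₂_eq hs ht]
  exact U.covDeriv_slice hs ht (U.jet_smooth 4)

theorem normalizedAiry_slice :
    normalizedAiry (fun y => F (s, t, y)) = fun y => airyField F (s, t, y) := by
  rw [normalizedAiry_eq (slice_contDiff hs ht U.smooth) (U.slice_immersed hs ht),
    U.unitTangent_eq hs ht, U.meanCurvature_eq hs ht, U.curvature₁_eq hs ht]
  rfl

theorem vfe_slice : vfe (fun y => F (s, t, y)) = fun y => vfeField F (s, t, y) := by
  ext1 x
  rw [vfe, U.unitTangent_eq hs ht, U.meanCurvature_eq hs ht]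
  rfl

end slice

theorem inner_one_one : ∀ p ∈ I ×ˢ J ×ˢ (univ : Set ℝ),
    inner ℝ (jet F 1 p) (jet F 1 p) = (1 : ℝ) := by
  rintro ⟨s, t, x⟩ ⟨hs, ht, -⟩
  have := inner_tangent_self (U.slice_immersed hs ht) x
  rwa [U.unitTangent_eq hs ht] at this

theorem inner_one_two : ∀ p ∈ I ×ˢ J ×ˢ (univ : Set ℝ),
    inner ℝ (jet F 1 p) (jet F 2 p) = (0 : ℝ) := by
  rintro ⟨s, t, x⟩ ⟨hs, ht, -⟩
  have := inner_tangent_meanCurvature (slice_contDiff hs ht U.smooth) (U.slice_immersed hs ht) x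
  rwa [U.unitTangent_eq hs ht, U.meanCurvature_eq hs ht] at this

theorem inner_one_four : ∀ p ∈ I ×ˢ J ×ˢ (univ : Set ℝ),
    inner ℝ (jet F 1 p) (jet F 4 p) = -3 * (inner ℝ (jet F 2 p) (jet F 3 p) : ℝ) := by
  rintro ⟨s, t, x⟩ ⟨hs, ht, -⟩
  have := inner_tangent_curvature₂ (slice_contDiff hs ht U.smooth) (U.slice_immersed hs ht) x
  rwa [U.unitTangent_eq hs ht, U.meanCurvature_eq hs ht, U.curvature₁_eq hs ht,
    U.curvature₂_eq hs ht] at this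

theorem inner_one_dd (v : ℝ × ℝ × ℝ) : ∀ p ∈ I ×ˢ J ×ˢ (univ : Set ℝ),
    inner ℝ (jet F 1 p) (jet (dd v F) 1 p) = (0 : ℝ) := by
  intro p hp
  have d1 := U.diffAt_jet 1 hp
  have h := dd_congr U.isOpen (G' := fun _ => (1 : ℝ)) U.inner_one_one v p hp
  rw [dd_inner d1 d1, dd_jet U.isOpen U.smooth v 1 p hp, real_inner_comm] at h
  have : dd v (fun _ : ℝ × ℝ × ℝ => (1 : ℝ)) p = 0 := by simp [dd]
  linarith

theorem norm_one : ∀ p ∈ I ×ˢ J ×ˢ (univ : Set ℝ), ‖jet F 1 p‖ = 1 := by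
  intro p hp
  have := U.inner_one_one p hp
  rw [real_inner_self_eq_norm_sq] at this
  exact (pow_eq_one_iff_of_nonneg (norm_nonneg _) two_ne_zero).1 this

theorem jet_airyField_one : ∀ p ∈ I ×ˢ J ×ˢ (univ : Set ℝ), jet (airyField F) 1 p =
    -((1 / 4 : ℝ) • jet F 4 p) - ((3 / 4 : ℝ) * inner ℝ (jet F 2 p) (jet F 3 p)) • jet F 1 p
      - ((3 / 8 : ℝ) * inner ℝ (jet F 2 p) (jet F 2 p)) • jet F 2 p := by
  rintro ⟨s, t, x⟩ ⟨hs, ht, -⟩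
  have h := covDeriv_normalizedAiry (slice_contDiff hs ht U.smooth) (U.slice_immersed hs ht)
  rw [U.normalizedAiry_slice hs ht, U.covDeriv_slice hs ht U.airyField_smooth,
    U.unitTangent_eq hs ht, U.meanCurvature_eq hs ht, U.curvature₁_eq hs ht,
    U.curvature₂_eq hs ht] at h
  exact congrFun h x

theorem jet_airyField_two : ∀ p ∈ I ×ˢ J ×ˢ (univ : Set ℝ), jet (airyField F) 2 p =
    -((1 / 4 : ℝ) • jet F 5 p)
      - ((3 / 4 : ℝ) * (inner ℝ (jet F 3 p) (jet F 3 p)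
        + inner ℝ (jet F 2 p) (jet F 4 p))) • jet F 1 p
      - ((3 / 2 : ℝ) * inner ℝ (jet F 2 p) (jet F 3 p)) • jet F 2 p
      - ((3 / 8 : ℝ) * inner ℝ (jet F 2 p) (jet F 2 p)) • jet F 3 p := by
  rintro ⟨s, t, x⟩ ⟨hs, ht, -⟩
  have h := covDeriv_covDeriv_normalizedAiry (slice_contDiff hs ht U.smooth)
    (U.slice_immersed hs ht)
  rw [U.normalizedAiry_slice hs ht, U.covDeriv_slice hs ht U.airyField_smooth,
    U.covDeriv_slice hs ht (contDiffOn_dd U.isOpen U.airyField_smooth _),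
    U.unitTangent_eq hs ht, U.meanCurvature_eq hs ht, U.curvature₁_eq hs ht,
    U.covDeriv_curvature₂_eq hs ht, U.curvature₂_eq hs ht] at h
  exact congrFun h x

theorem jet_vfeField_one : ∀ p ∈ I ×ˢ J ×ˢ (univ : Set ℝ), jet (vfeField F) 1 p =
    (1 / 2 : ℝ) • cross (jet F 1 p) (jet F 3 p) := by
  rintro ⟨s, t, x⟩ ⟨hs, ht, -⟩
  have h := covDeriv_vfe (slice_contDiff hs ht U.smooth) (U.slice_immersed hs ht)
  rw [U.vfe_slice hs ht, U.covDeriv_slice hs ht U.vfeField_smooth,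
    U.unitTangent_eq hs ht, U.curvature₁_eq hs ht] at h
  exact congrFun h x

theorem jet_vfeField_two : ∀ p ∈ I ×ˢ J ×ˢ (univ : Set ℝ), jet (vfeField F) 2 p =
    (1 / 2 : ℝ) • (cross (jet F 2 p) (jet F 3 p) + cross (jet F 1 p) (jet F 4 p)) := by
  rintro ⟨s, t, x⟩ ⟨hs, ht, -⟩
  have h := covDeriv_covDeriv_vfe (slice_contDiff hs ht U.smooth) (U.slice_immersed hs ht)
  rw [U.vfe_slice hs ht, U.covDeriv_slice hs ht U.vfeField_smooth,
    U.covDeriv_slice hs ht (contDiffOn_dd U.isOpen U.vfeField_smooth _),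
    U.unitTangent_eq hs ht, U.meanCurvature_eq hs ht, U.curvature₁_eq hs ht,
    U.curvature₂_eq hs ht] at h
  exact congrFun h x

theorem jet_vfeField_three : ∀ p ∈ I ×ˢ J ×ˢ (univ : Set ℝ), jet (vfeField F) 3 p =
    (1 / 2 : ℝ) • ((2 : ℝ) • cross (jet F 2 p) (jet F 4 p)
      + cross (jet F 1 p) (jet F 5 p)) := by
  rintro ⟨s, t, x⟩ ⟨hs, ht, -⟩
  have h := covDeriv_covDeriv_covDeriv_vfe (slice_contDiff hs ht U.smooth)
    (U.slice_immersed hs ht)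
  rw [U.vfe_slice hs ht, U.covDeriv_slice hs ht U.vfeField_smooth,
    U.covDeriv_slice hs ht (contDiffOn_dd U.isOpen U.vfeField_smooth _),
    U.covDeriv_slice hs ht (contDiffOn_dd U.isOpen (contDiffOn_dd U.isOpen U.vfeField_smooth _) _),
    U.unitTangent_eq hs ht, U.meanCurvature_eq hs ht,
    U.covDeriv_curvature₂_eq hs ht, U.curvature₂_eq hs ht] at h
  exact congrFun h x

/-- The linearized normalized Airy operator. -/
theorem dT_sub_vfeField (hA : ∀ p ∈ I ×ˢ J ×ˢ (univ : Set ℝ), dT F p = airyField F p) :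
    ∀ p ∈ I ×ˢ J ×ˢ (univ : Set ℝ), dT (fun q => dS F q - vfeField F q) p =
    -((1 / 4 : ℝ) • jet (fun q => dS F q - vfeField F q) 3 p)
      - ((3 / 4 : ℝ) * inner ℝ (jet F 2 p) (jet (fun q => dS F q - vfeField F q) 2 p)) • jet F 1 p
      - ((3 / 8 : ℝ) * inner ℝ (jet F 2 p) (jet F 2 p)) •
        jet (fun q => dS F q - vfeField F q) 1 p := by
  intro p hp
  have hΩ := U.isOpen
  have hS := contDiffOn_dd hΩ U.smooth (1, 0, 0)
  rw [dT, dd_sub (U.diffAt hS hp) (U.diffAt U.vfeField_smooth hp), dd_comm hΩ U.smooth hp,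
    dd_congr hΩ hA _ p hp, U.dd_airyField _ p hp, U.dd_vfeField _ p hp]
  simp only [jet_sub hΩ hS U.vfeField_smooth _ p hp, jet_congr hΩ hA _ p hp]
  -- Differentiating F_t = X(F) and Y(F) gives W_t = dX(F_s) - dY(X). The bracket identity replaces
  -- dY(X) by dX(Y), leaving dX(W).
  have key := bracket_algebra (c := jet F 3 p) (e := jet F 5 p) (U.inner_one_one p hp)
    (U.inner_one_two p hp) (U.inner_one_four p hp)
  rw [U.jet_airyField_one p hp, U.jet_airyField_two p hp, ← key, ← U.jet_vfeField_three p hp,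
    ← U.jet_vfeField_two p hp, ← U.jet_vfeField_one p hp, inner_sub_right]
  module

/-- The linearized vortex filament operator. -/
theorem dT_sub_airyField (hV : ∀ p ∈ I ×ˢ J ×ˢ (univ : Set ℝ), dT F p = vfeField F p) :
    ∀ p ∈ I ×ˢ J ×ˢ (univ : Set ℝ), dT (fun q => dS F q - airyField F q) p =
    (1 / 2 : ℝ) • (cross (jet (fun q => dS F q - airyField F q) 1 p) (jet F 2 p)
      + cross (jet F 1 p) (jet (fun q => dS F q - airyField F q) 2 p)) := by
  intro p hp
  have hΩ := U.isOpen
  have hS := contDiffOn_dd hΩ U.smooth (1, 0, 0)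
  rw [dT, dd_sub (U.diffAt hS hp) (U.diffAt U.airyField_smooth hp), dd_comm hΩ U.smooth hp,
    dd_congr hΩ hV _ p hp, U.dd_airyField _ p hp, U.dd_vfeField _ p hp]
  simp only [jet_sub hΩ hS U.airyField_smooth _ p hp, jet_congr hΩ hV _ p hp]
  have key := bracket_algebra (c := jet F 3 p) (e := jet F 5 p) (U.inner_one_one p hp)
    (U.inner_one_two p hp) (U.inner_one_four p hp)
  rw [← U.jet_airyField_one p hp, ← U.jet_airyField_two p hp, ← U.jet_vfeField_three p hp,
    ← U.jet_vfeField_two p hp, ← U.jet_vfeField_one p hp] at key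
  rw [key]
  apply ext_coord <;> simp <;> ring

/-- Both terms of W preserve unit speed to first order: F_s because |F_x| = 1 throughout the family,
Y by its formula. Hence W_x ⊥ e₀. -/
theorem inner_one_sub_vfeField : ∀ p ∈ I ×ˢ J ×ˢ (univ : Set ℝ),
    inner ℝ (jet F 1 p) (jet (fun q => dS F q - vfeField F q) 1 p) = (0 : ℝ) := by
  intro p hp
  rw [jet_sub U.isOpen (contDiffOn_dd U.isOpen U.smooth _) U.vfeField_smooth _ p hp,
    inner_sub_right, U.inner_one_dd _ p hp, U.jet_vfeField_one p hp, inner_smul_right,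
    inner_self_cross]
  ring

theorem inner_one_sub_airyField : ∀ p ∈ I ×ˢ J ×ˢ (univ : Set ℝ),
    inner ℝ (jet F 1 p) (jet (fun q => dS F q - airyField F q) 1 p) = (0 : ℝ) := by
  intro p hp
  rw [jet_sub U.isOpen (contDiffOn_dd U.isOpen U.smooth _) U.airyField_smooth _ p hp,
    inner_sub_right, U.inner_one_dd _ p hp, U.jet_airyField_one p hp]
  simp only [inner_sub_right, inner_neg_right, inner_smul_right, U.inner_one_one p hp,
    U.inner_one_two p hp, U.inner_one_four p hp]
  ring

end UnitFamily

/-! ### Behaviour at infinity -/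

section infinity

/-- The increments of `B` over suitable arbitrarily long intervals are small. -/
def SmallIncrements (K : Set ℝ) (B : ℝ × ℝ → ℝ) : Prop :=
  ∀ ε > 0, ∀ M : ℝ, ∃ a b, a < -M ∧ M < b ∧ ∀ t ∈ K, |B (t, b) - B (t, a)| ≤ ε

/-- The interval [-nL, nL] consists of whole periods, so the increment is exactly zero. -/
theorem SmallIncrements.of_periodic {K : Set ℝ} {B : ℝ × ℝ → ℝ} {L : ℝ} (hL : 0 < L)
    (h : ∀ t ∈ K, ∀ x, B (t, x + L) = B (t, x)) : SmallIncrements K B := by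
  intro ε hε M
  obtain ⟨n, hn⟩ := exists_nat_gt (M / L)
  rw [div_lt_iff₀ hL] at hn
  refine ⟨-(n * L), n * L, by linarith, hn, fun t ht => ?_⟩
  have hp : Function.Periodic (fun x => B (t, x)) L := h t ht
  have h1 := hp.nat_mul_eq n
  have h2 := (hp.nat_mul n).neg_eq
  have h3 : B (t, n * L) = B (t, -(n * L)) := by
    rw [h1, ← h2]
  rw [h3, sub_self, abs_zero]
  exact hε.le

variable {E E' E'' : Type*} [NormedAddCommGroup E] [NormedSpace ℝ E] [NormedAddCommGroup E']
  [NormedSpace ℝ E'] [NormedAddCommGroup E''] [NormedSpace ℝ E''] {K : Set ℝ}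

/-- Rapid decay in `x`, uniformly for `t ∈ K`. -/
def Decays (K : Set ℝ) (f : ℝ × ℝ → E) : Prop :=
  ∀ N : ℕ, ∃ C : ℝ, ∀ t ∈ K, ∀ x, |x| ^ N * ‖f (t, x)‖ ≤ C

/-- Polynomial growth in `x`, uniformly for `t ∈ K`. -/
def Tempered (K : Set ℝ) (f : ℝ × ℝ → E) : Prop :=
  ∃ m : ℕ, ∃ C : ℝ, ∀ t ∈ K, ∀ x, ‖f (t, x)‖ ≤ C * (1 + |x|) ^ m

omit [NormedSpace ℝ E] in
theorem Decays.bounded {f : ℝ × ℝ → E} (hf : Decays K f) :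
    ∃ C, ∀ t ∈ K, ∀ x, ‖f (t, x)‖ ≤ C := by
  obtain ⟨C, hC⟩ := hf 0
  exact ⟨C, fun t ht x => by simpa using hC t ht x⟩

omit [NormedSpace ℝ E] in
theorem Tempered.of_bounded {f : ℝ × ℝ → E} {C : ℝ} (h : ∀ t ∈ K, ∀ x, ‖f (t, x)‖ ≤ C) :
    Tempered K f := ⟨0, C, fun t ht x => by simpa using h t ht x⟩

omit [NormedSpace ℝ E] in
theorem Decays.tempered {f : ℝ × ℝ → E} (hf : Decays K f) : Tempered K f :=
  let ⟨_, hC⟩ := hf.bounded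
  .of_bounded hC

omit [NormedSpace ℝ E] in
theorem Decays.congr {f g : ℝ × ℝ → E} (hf : Decays K f) (h : ∀ t ∈ K, ∀ x, g (t, x) = f (t, x)) :
    Decays K g := fun N =>
  let ⟨C, hC⟩ := hf N
  ⟨C, fun t ht x => by rw [h t ht x]; exact hC t ht x⟩

omit [NormedSpace ℝ E] in
theorem Tempered.congr {f g : ℝ × ℝ → E} (hf : Tempered K f)
    (h : ∀ t ∈ K, ∀ x, g (t, x) = f (t, x)) : Tempered K g :=
  let ⟨m, C, hC⟩ := hf
  ⟨m, C, fun t ht x => by rw [h t ht x]; exact hC t ht x⟩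

omit [NormedSpace ℝ E] in
theorem Decays.add {f g : ℝ × ℝ → E} (hf : Decays K f) (hg : Decays K g) :
    Decays K (fun p => f p + g p) := by
  intro N
  obtain ⟨C, hC⟩ := hf N
  obtain ⟨C', hC'⟩ := hg N
  refine ⟨C + C', fun t ht x => ?_⟩
  calc |x| ^ N * ‖f (t, x) + g (t, x)‖ ≤ |x| ^ N * (‖f (t, x)‖ + ‖g (t, x)‖) := by
        gcongr; exact norm_add_le _ _
    _ ≤ C + C' := by rw [mul_add]; exact add_le_add (hC t ht x) (hC' t ht x)

/-- Growth of order `m` in `g` is absorbed by the decay of `f` at order `N + m`. Inner products,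
cross products and scalar multiples are all instances. -/
theorem Decays.bilin (B : E →L[ℝ] E' →L[ℝ] E'') {f : ℝ × ℝ → E} {g : ℝ × ℝ → E'}
    (hf : Decays K f) (hg : Tempered K g) : Decays K (fun p => B (f p) (g p)) := by
  intro N
  obtain ⟨m, D, hD⟩ := hg
  obtain ⟨C, hC⟩ := hf N
  obtain ⟨C', hC'⟩ := hf (N + m)
  refine ⟨‖B‖ * (|D| * (2 ^ (m - 1) * (C + C'))), fun t ht x => ?_⟩
  have h1 : ‖B (f (t, x)) (g (t, x))‖ ≤ ‖B‖ * ‖f (t, x)‖ * (|D| * (1 + |x|) ^ m) := by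
    refine (B.le_opNorm₂ _ _).trans ?_
    gcongr
    refine (hD t ht x).trans ?_
    gcongr
    exact le_abs_self D
  have h2 : (1 + |x|) ^ m ≤ 2 ^ (m - 1) * (1 ^ m + |x| ^ m) :=
    add_pow_le zero_le_one (abs_nonneg x) m
  calc |x| ^ N * ‖B (f (t, x)) (g (t, x))‖
      ≤ |x| ^ N * (‖B‖ * ‖f (t, x)‖ * (|D| * (2 ^ (m - 1) * (1 ^ m + |x| ^ m)))) := by
        gcongr
        exact h1.trans (by gcongr)
    _ = ‖B‖ * (|D| * (2 ^ (m - 1) * (|x| ^ N * ‖f (t, x)‖ + |x| ^ (N + m) * ‖f (t, x)‖))) := by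
        rw [one_pow, pow_add]; ring
    _ ≤ _ := by
        gcongr
        · exact hC t ht x
        · exact hC' t ht x

theorem Tempered.bilin (B : E →L[ℝ] E' →L[ℝ] E'') {f : ℝ × ℝ → E} {g : ℝ × ℝ → E'}
    (hf : Tempered K f) (hg : Tempered K g) : Tempered K (fun p => B (f p) (g p)) := by
  obtain ⟨m, D, hD⟩ := hg
  obtain ⟨n, C, hC⟩ := hf
  refine ⟨n + m, ‖B‖ * (|C| * |D|), fun t ht x => ?_⟩
  refine (B.le_opNorm₂ _ _).trans ?_
  calc ‖B‖ * ‖f (t, x)‖ * ‖g (t, x)‖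
      ≤ ‖B‖ * (|C| * (1 + |x|) ^ n) * (|D| * (1 + |x|) ^ m) := by
        gcongr
        · refine (hC t ht x).trans ?_
          gcongr
          exact le_abs_self C
        · refine (hD t ht x).trans ?_
          gcongr
          exact le_abs_self D
    _ = _ := by rw [pow_add]; ring

omit [NormedSpace ℝ E] in
theorem Tempered.add {f g : ℝ × ℝ → E} (hf : Tempered K f) (hg : Tempered K g) :
    Tempered K (fun p => f p + g p) := by
  obtain ⟨m, D, hD⟩ := hg
  obtain ⟨n, C, hC⟩ := hf
  refine ⟨n + m, |C| + |D|, fun t ht x => ?_⟩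
  have hx : 1 ≤ 1 + |x| := by linarith [abs_nonneg x]
  refine (norm_add_le _ _).trans ?_
  rw [add_mul]
  refine add_le_add ((hC t ht x).trans ?_) ((hD t ht x).trans ?_)
  · exact mul_le_mul (le_abs_self C) (pow_le_pow_right₀ hx (by omega)) (by positivity)
      (by positivity)
  · exact mul_le_mul (le_abs_self D) (pow_le_pow_right₀ hx (by omega)) (by positivity)
      (by positivity)

theorem Decays.const_smul {f : ℝ × ℝ → E} (hf : Decays K f) (c : ℝ) :
    Decays K (fun p => c • f p) := by
  intro N
  obtain ⟨C, hC⟩ := hf N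
  refine ⟨|c| * C, fun t ht x => ?_⟩
  rw [norm_smul, Real.norm_eq_abs, mul_left_comm]
  exact mul_le_mul_of_nonneg_left (hC t ht x) (abs_nonneg c)

omit [NormedSpace ℝ E] in
theorem Decays.neg {f : ℝ × ℝ → E} (hf : Decays K f) : Decays K (fun p => -f p) := fun N =>
  let ⟨C, hC⟩ := hf N
  ⟨C, fun t ht x => by rw [norm_neg]; exact hC t ht x⟩

omit [NormedSpace ℝ E] in
theorem Decays.sub {f g : ℝ × ℝ → E} (hf : Decays K f) (hg : Decays K g) :
    Decays K (fun p => f p - g p) :=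
  (hf.add hg.neg).congr fun _ _ _ => sub_eq_add_neg _ _

theorem Decays.inner_left {f g : ℝ × ℝ → E3} (hf : Decays K f) (hg : Tempered K g) :
    Decays K (fun p => (inner ℝ (f p) (g p) : ℝ)) := hf.bilin (innerSL ℝ) hg

theorem Decays.inner_right {f g : ℝ × ℝ → E3} (hf : Tempered K f) (hg : Decays K g) :
    Decays K (fun p => (inner ℝ (f p) (g p) : ℝ)) :=
  (hg.inner_left hf).congr fun _ _ _ => real_inner_comm _ _

theorem Tempered.inner_tempered {f g : ℝ × ℝ → E3} (hf : Tempered K f) (hg : Tempered K g) :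
    Tempered K (fun p => (inner ℝ (f p) (g p) : ℝ)) := hf.bilin (innerSL ℝ) hg

theorem Decays.cross_left {f g : ℝ × ℝ → E3} (hf : Decays K f) (hg : Tempered K g) :
    Decays K (fun p => cross (f p) (g p)) := hf.bilin crossL hg

theorem Decays.cross_right {f g : ℝ × ℝ → E3} (hf : Tempered K f) (hg : Decays K g) :
    Decays K (fun p => cross (f p) (g p)) := hg.bilin crossL.flip hf

theorem Decays.smul {f : ℝ × ℝ → ℝ} {g : ℝ × ℝ → E} (hf : Decays K f) (hg : Tempered K g) :
    Decays K (fun p => f p • g p) := hf.bilin (ContinuousLinearMap.lsmul ℝ ℝ) hg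

theorem Decays.smallIncrements {B : ℝ × ℝ → ℝ} (hB : Decays K B) : SmallIncrements K B := by
  intro ε hε M
  obtain ⟨C, hC⟩ := hB 1
  -- Decay of first order suffices: R ≥ 2C/ε forces |B| ≤ ε/2 at both ends ±R.
  set R := max (M + 1) (max 1 (2 * C / ε)) with hR
  have hR1 : 1 ≤ R := (le_max_left _ _).trans (le_max_right _ _)
  have hRM : M < R := lt_of_lt_of_le (by linarith) (le_max_left _ _)
  have hRC : 2 * C / ε ≤ R := (le_max_right _ _).trans (le_max_right _ _)
  rw [div_le_iff₀ hε] at hRC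
  have key : ∀ t ∈ K, ∀ x, |x| = R → |B (t, x)| ≤ ε / 2 := by
    intro t ht x hx
    have := hC t ht x
    rw [hx, pow_one, Real.norm_eq_abs] at this
    by_contra! hlt
    nlinarith
  refine ⟨-R, R, by linarith, hRM, fun t ht => ?_⟩
  have h1 := key t ht R (abs_of_pos (by linarith))
  have h2 := key t ht (-R) (by rw [abs_neg]; exact abs_of_pos (by linarith))
  rw [abs_le] at *
  constructor <;> linarith [h1.1, h1.2, h2.1, h2.2]

/-- A field with bounded derivative has linear growth. -/
theorem Tempered.of_deriv {f f' : ℝ × ℝ → E} (hK : IsCompact K)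
    (hf : ContinuousOn f (K ×ˢ univ))
    (hd : ∀ t ∈ K, ∀ x, HasDerivAt (fun y => f (t, y)) (f' (t, x)) x)
    (hf' : Decays K f') : Tempered K f := by
  obtain ⟨C, hC⟩ := hf'.bounded
  obtain ⟨D, hD⟩ := hK.exists_bound_of_continuousOn (f := fun t => f (t, 0))
    (hf.comp (by fun_prop) (fun t ht => ⟨ht, mem_univ _⟩))
  refine ⟨1, |C| + |D|, fun t ht x => ?_⟩
  have h1 := convex_univ.norm_image_sub_le_of_norm_hasDerivWithin_le (C := C)
    (fun y _ => (hd t ht y).hasDerivWithinAt) (fun y _ => hC t ht y) (mem_univ 0) (mem_univ x)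
  have h2 := hD t ht
  rw [sub_zero, Real.norm_eq_abs] at h1
  have h3 : ‖f (t, x)‖ ≤ ‖f (t, x) - f (t, 0)‖ + ‖f (t, 0)‖ := by
    simpa using norm_add_le (f (t, x) - f (t, 0)) (f (t, 0))
  rw [pow_one]
  nlinarith [abs_nonneg x, abs_nonneg C, abs_nonneg D, le_abs_self C, le_abs_self D,
    mul_le_mul_of_nonneg_right (le_abs_self C) (abs_nonneg x),
    mul_nonneg (abs_nonneg D) (abs_nonneg x)]

omit [NormedSpace ℝ E] in
theorem bounded_of_periodic (hK : IsCompact K) {f : ℝ × ℝ → E} (hf : ContinuousOn f (K ×ˢ univ))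
    {L : ℝ} (hL : 0 < L) (h : ∀ t ∈ K, ∀ x, f (t, x + L) = f (t, x)) :
    ∃ C, ∀ t ∈ K, ∀ x, ‖f (t, x)‖ ≤ C := by
  obtain ⟨C, hC⟩ := (hK.prod (isCompact_Icc (a := 0) (b := L))).exists_bound_of_continuousOn
    (hf.mono (prod_mono_right (subset_univ _)))
  refine ⟨C, fun t ht x => ?_⟩
  have hp : Function.Periodic (fun x => f (t, x)) L := h t ht
  obtain ⟨y, hy, hxy⟩ := hp.exists_mem_Ico₀ hL x
  rw [show f (t, x) = f (t, y) from hxy]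
  exact hC (t, y) ⟨ht, Ico_subset_Icc_self hy⟩

end infinity

/-! ### Decay and periodicity pass to derivatives of a family -/

section families

variable {E : Type*} [NormedAddCommGroup E] [NormedSpace ℝ E] {I J : Set ℝ}

/-- Rapid decay of a function together with its derivatives, locally uniformly in the times. -/
def RapidDecay (I J : Set ℝ) (f : ℝ × ℝ × ℝ → E) : Prop :=
  ContDiffOn ℝ ∞ f (I ×ˢ J ×ˢ univ) ∧ ∀ n N : ℕ, ∀ K : Set (ℝ × ℝ), IsCompact K → K ⊆ I ×ˢ J →
    ∃ C : ℝ, ∀ p ∈ K, ∀ x : ℝ, |x| ^ N * ‖iteratedFDeriv ℝ n f (p.1, p.2, x)‖ ≤ C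

/-- Evaluation at `v` is a continuous linear map, so n derivatives of `dd v f` are controlled by n +
1 derivatives of `f`. -/
theorem RapidDecay.dd (hI : IsOpen I) (hJ : IsOpen J) {f : ℝ × ℝ × ℝ → E}
    (hf : RapidDecay I J f) (v : ℝ × ℝ × ℝ) : RapidDecay I J (dd v f) := by
  have hΩ : IsOpen (I ×ˢ J ×ˢ (univ : Set ℝ)) := hI.prod (hJ.prod isOpen_univ)
  refine ⟨contDiffOn_dd hΩ hf.1 v, fun n N K hK hKs => ?_⟩
  obtain ⟨C, hC⟩ := hf.2 (n + 1) N K hK hKs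
  refine ⟨‖ContinuousLinearMap.apply ℝ E v‖ * C, fun p hp x => ?_⟩
  have hp' : (p.1, p.2, x) ∈ I ×ˢ J ×ˢ (univ : Set ℝ) := ⟨(hKs hp).1, (hKs hp).2, mem_univ _⟩
  have h := (ContinuousLinearMap.apply ℝ E v).norm_iteratedFDeriv_comp_left (n := n)
    ((hf.1.fderiv_of_isOpen (m := ∞) hΩ (by simp)).contDiffAt (hΩ.mem_nhds hp'))
    (by exact_mod_cast le_top)
  rw [norm_iteratedFDeriv_fderiv] at h
  calc |x| ^ N * ‖iteratedFDeriv ℝ n (CurveFlow.dd v f) (p.1, p.2, x)‖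
      ≤ |x| ^ N * (‖ContinuousLinearMap.apply ℝ E v‖ *
          ‖iteratedFDeriv ℝ (n + 1) f (p.1, p.2, x)‖) :=
        mul_le_mul_of_nonneg_left h (by positivity)
    _ = ‖ContinuousLinearMap.apply ℝ E v‖ *
          (|x| ^ N * ‖iteratedFDeriv ℝ (n + 1) f (p.1, p.2, x)‖) := by
        ring
    _ ≤ _ := by
        gcongr
        exact hC p hp x

theorem RapidDecay.jet (hI : IsOpen I) (hJ : IsOpen J) {f : ℝ × ℝ × ℝ → E}
    (hf : RapidDecay I J f) : ∀ n, RapidDecay I J (jet f n)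
  | 0 => hf
  | n + 1 => (RapidDecay.jet hI hJ hf n).dd hI hJ _

theorem RapidDecay.decays {f : ℝ × ℝ × ℝ → E} (hf : RapidDecay I J f) {s : ℝ} (hs : s ∈ I)
    {K : Set ℝ} (hK : IsCompact K) (hKJ : K ⊆ J) :
    Decays K (fun p : ℝ × ℝ => f (s, p.1, p.2)) := by
  intro N
  obtain ⟨C, hC⟩ := hf.2 0 N ({s} ×ˢ K) (isCompact_singleton.prod hK)
    (prod_mono (singleton_subset_iff.2 hs) hKJ)
  refine ⟨C, fun t ht x => ?_⟩
  have := hC (s, t) ⟨rfl, ht⟩ x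
  rwa [norm_iteratedFDeriv_zero] at this

theorem dd_periodic (hI : IsOpen I) (hJ : IsOpen J) {f : ℝ × ℝ × ℝ → E} {L : ℝ}
    (hf : ∀ s ∈ I, ∀ t ∈ J, ∀ x, f (s, t, x + L) = f (s, t, x)) (v : ℝ × ℝ × ℝ) :
    ∀ s ∈ I, ∀ t ∈ J, ∀ x, dd v f (s, t, x + L) = dd v f (s, t, x) := by
  intro s hs t ht x
  have hΩ : IsOpen (I ×ˢ J ×ˢ (univ : Set ℝ)) := hI.prod (hJ.prod isOpen_univ)
  have h1 : (fun q : ℝ × ℝ × ℝ => f (q + (0, 0, L))) =ᶠ[𝓝 (s, t, x)] f := by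
    filter_upwards [hΩ.mem_nhds ⟨hs, ht, mem_univ x⟩] with q hq
    have e : q + (0, 0, L) = (q.1, q.2.1, q.2.2 + L) := by simp [Prod.ext_iff]
    rw [e]
    exact hf q.1 hq.1 q.2.1 hq.2.1 q.2.2
  have h2 := h1.fderiv_eq (𝕜 := ℝ)
  rw [fderiv_comp_add_right] at h2
  simp only [Prod.mk_add_mk, add_zero] at h2
  rw [dd, dd, h2]

theorem jet_periodic (hI : IsOpen I) (hJ : IsOpen J) {f : ℝ × ℝ × ℝ → E} {L : ℝ}
    (hf : ∀ s ∈ I, ∀ t ∈ J, ∀ x, f (s, t, x + L) = f (s, t, x)) :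
    ∀ n, ∀ s ∈ I, ∀ t ∈ J, ∀ x, jet f n (s, t, x + L) = jet f n (s, t, x)
  | 0 => hf
  | n + 1 => dd_periodic hI hJ (jet_periodic hI hJ hf n) _

end families

namespace UnitFamily

/-! ### Uniqueness for the linearized flows -/

section linear

variable {I J : Set ℝ} {F W : ℝ × ℝ × ℝ → E3}

/-- The energy flux of the linearized normalized Airy flow. -/
def airyFlux (F W : ℝ × ℝ × ℝ → E3) (p : ℝ × ℝ × ℝ) : ℝ :=
  -(1 / 2 : ℝ) * inner ℝ (jet W 1 p) (jet W 3 p) + (1 / 4 : ℝ) * inner ℝ (jet W 2 p) (jet W 2 p)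
    - (3 / 4 : ℝ) * (inner ℝ (jet W 1 p) (jet F 2 p) * inner ℝ (jet W 1 p) (jet F 2 p))
    - (3 / 8 : ℝ) * (inner ℝ (jet F 2 p) (jet F 2 p) * inner ℝ (jet W 1 p) (jet W 1 p))

/-- The energy flux of the linearized vortex filament flow. -/
def vfeFlux (F W : ℝ × ℝ × ℝ → E3) (p : ℝ × ℝ × ℝ) : ℝ :=
  inner ℝ (jet W 1 p) (cross (jet F 1 p) (jet W 2 p))

/-- The curvature is bounded along the curves `F (s, t, ·)`, `t ∈ K`, and the flux `B` has small
increments over arbitrarily long intervals. -/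
def Controlled (F : ℝ × ℝ × ℝ → E3) (B : ℝ × ℝ × ℝ → ℝ) (s : ℝ) (K : Set ℝ) : Prop :=
  (∃ C, ∀ t ∈ K, ∀ x, ‖jet F 2 (s, t, x)‖ ≤ C) ∧ (∃ C, ∀ t ∈ K, ∀ x, ‖jet F 3 (s, t, x)‖ ≤ C) ∧
    SmallIncrements K (fun p => B (s, p.1, p.2))

variable (U : UnitFamily I J F) (hJ' : J.OrdConnected)
  (hW : ContDiffOn ℝ ∞ W (I ×ˢ J ×ˢ univ))
  {s t₀ : ℝ} (hs : s ∈ I) (ht₀ : t₀ ∈ J) (h0 : ∀ x, W (s, t₀, x) = 0)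
include U hJ' hW hs ht₀ h0

omit hJ' ht₀ h0 in
theorem jet_succ_eq_zero {t : ℝ} (ht : t ∈ J) (n : ℕ) (h : ∀ x, jet W n (s, t, x) = 0) (x : ℝ) :
    jet W (n + 1) (s, t, x) = 0 := by
  have h1 := hasDerivAt_dX (U.diffAt (contDiffOn_jet U.isOpen hW n) ⟨hs, ht, mem_univ x⟩)
  simp only [h] at h1
  exact h1.unique (hasDerivAt_const x _)

omit ht₀ h0 in
/-- If the energy density `|W_x|²` satisfies a balance law with controlled flux, then `W_x`
vanishes identically. -/
theorem jet_one_eq_zero_of_balance (hinit : ∀ x, W (s, t₀, x) = 0) (ht₀ : t₀ ∈ J)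
    {B : ℝ × ℝ × ℝ → ℝ} {r : ℝ × ℝ × ℝ → ℝ} (hr : ContDiffOn ℝ ∞ r (I ×ˢ J ×ˢ univ))
    (hB : ∀ t ∈ J, ∀ x, HasDerivAt (fun y => B (s, t, y))
      (2 * inner ℝ (jet W 1 (s, t, x)) (dT (jet W 1) (s, t, x)) - r (s, t, x)) x)
    {t₁ : ℝ} (ht₁ : t₁ ∈ J)
    (hrC : ∃ C, ∀ t ∈ uIcc t₀ t₁, ∀ x, |r (s, t, x)| ≤ C * ‖jet W 1 (s, t, x)‖ ^ 2)
    (hBd : SmallIncrements (uIcc t₀ t₁) (fun p => B (s, p.1, p.2))) (x : ℝ) :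
    jet W 1 (s, t₁, x) = 0 := by
  have hΩ := U.isOpen
  have hw := contDiffOn_jet hΩ hW 1
  have hwt := contDiffOn_dd hΩ hw (0, 1, 0)
  have slice : ∀ {f : ℝ × ℝ × ℝ → ℝ}, ContDiffOn ℝ ∞ f (I ×ˢ J ×ˢ univ) →
      ContinuousOn (fun p : ℝ × ℝ => f (s, p.1, p.2)) (J ×ˢ univ) := fun hf =>
    hf.continuousOn.comp (by fun_prop) (fun p hp => ⟨hs, hp.1, mem_univ _⟩)
  have hw0 := U.jet_succ_eq_zero hW hs ht₀ 0 hinit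
  obtain ⟨C, hC⟩ := hrC
  have key := energy_eq_zero U.openJ hJ' ht₀ ht₁
    (e := fun p => inner ℝ (jet W 1 (s, p.1, p.2)) (jet W 1 (s, p.1, p.2)))
    (e' := fun p => 2 * inner ℝ (jet W 1 (s, p.1, p.2)) (dT (jet W 1) (s, p.1, p.2)))
    (B := fun p => B (s, p.1, p.2)) (r := fun p => r (s, p.1, p.2))
    (slice (hw.inner ℝ hw)) (slice (contDiffOn_const.mul (hw.inner ℝ hwt))) (slice hr)
    (fun t _ x => real_inner_self_nonneg) (fun x => by rw [hw0 x, inner_zero_left])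
    (fun t ht x => by
      have h1 := hasDerivAt_dT (U.diffAt hw ⟨hs, ht, mem_univ x⟩)
      refine (h1.inner ℝ h1).congr_deriv ?_
      rw [real_inner_comm (jet W 1 (s, t, x))]
      ring)
    hB (C := C)
    (fun t ht x => by rw [real_inner_self_eq_norm_sq]; exact hC t ht x) hBd x
  exact inner_self_eq_zero.1 key

-- If W_x = 0 on every curve, then W_xx and W_xxx vanish as well, so the equation gives W_t = 0 and
-- W keeps its zero initial value.
omit hJ' in
theorem eq_zero_of_jet_one (h1 : ∀ t ∈ J, ∀ x, jet W 1 (s, t, x) = 0)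
    (hT : ∀ t ∈ J, ∀ x, jet W 1 (s, t, x) = 0 → jet W 2 (s, t, x) = 0 → jet W 3 (s, t, x) = 0 →
      dT W (s, t, x) = 0) (hJ' : J.OrdConnected) {t : ℝ} (ht : t ∈ J) (x : ℝ) :
    W (s, t, x) = 0 := by
  have hd : ∀ τ ∈ J, HasDerivAt (fun τ => W (s, τ, x)) 0 τ := by
    intro τ hτ
    have h2 := U.jet_succ_eq_zero hW hs hτ 1 (h1 τ hτ)
    have h3 := U.jet_succ_eq_zero hW hs hτ 2 h2
    rw [← hT τ hτ x (h1 τ hτ x) (h2 x) (h3 x)]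
    exact hasDerivAt_dT (U.diffAt hW ⟨hs, hτ, mem_univ x⟩)
  have := hJ'.convex.norm_image_sub_le_of_norm_hasDerivWithin_le (C := 0)
    (fun t ht => (hd t ht).hasDerivWithinAt) (by simp) ht₀ ht
  simpa [h0 x] using this

/-- The dispersive term -¼W_xxx contributes a pure flux to the balance of |W_x|². In the e₀-term,
orthogonality removes the part with ⟨H, W_xxx⟩, and ⟨H, W_xx⟩⟨H, W_x⟩ is absorbed by the derivative
of ⟨W_x, H⟩². What remains is quadratic in W_x with coefficients built from F_xx and F_xxx. -/
theorem linearAiry_eq_zero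
    (hperp : ∀ p ∈ I ×ˢ J ×ˢ (univ : Set ℝ), inner ℝ (jet F 1 p) (jet W 1 p) = (0 : ℝ))
    (heq : ∀ p ∈ I ×ˢ J ×ˢ (univ : Set ℝ), dT W p = -((1 / 4 : ℝ) • jet W 3 p)
      - ((3 / 4 : ℝ) * inner ℝ (jet F 2 p) (jet W 2 p)) • jet F 1 p
      - ((3 / 8 : ℝ) * inner ℝ (jet F 2 p) (jet F 2 p)) • jet W 1 p)
    (hctrl : ∀ t₁ ∈ J, Controlled F (airyFlux F W) s (uIcc t₀ t₁)) :
    ∀ t ∈ J, ∀ x, W (s, t, x) = 0 := by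
  have hΩ := U.isOpen
  have cW := contDiffOn_jet hΩ hW
  have hwt : ∀ p ∈ I ×ˢ J ×ˢ (univ : Set ℝ), dT (jet W 1) p = -((1 / 4 : ℝ) • jet W 4 p)
      - (((3 / 4 : ℝ) * (inner ℝ (jet F 3 p) (jet W 2 p) + inner ℝ (jet F 2 p) (jet W 3 p)))
        • jet F 1 p + ((3 / 4 : ℝ) * inner ℝ (jet F 2 p) (jet W 2 p)) • jet F 2 p)
      - (((3 / 8 : ℝ) * (2 * inner ℝ (jet F 2 p) (jet F 3 p))) • jet W 1 p
        + ((3 / 8 : ℝ) * inner ℝ (jet F 2 p) (jet F 2 p)) • jet W 2 p) := by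
    intro p hp
    have f1 := U.diffAt_jet 1 hp
    have f2 := U.diffAt_jet 2 hp
    have w1 := U.diffAt (cW 1) hp
    have w2 := U.diffAt (cW 2) hp
    have w3 := U.diffAt (cW 3) hp
    rw [dT, dd_jet hΩ hW _ 1 p hp, jet_congr hΩ heq 1 p hp]
    have g1 := (f2.inner ℝ w2).const_mul (3 / 4 : ℝ)
    have g2 := (f2.inner ℝ f2).const_mul (3 / 8 : ℝ)
    have g3 := (w3.fun_const_smul (1 / 4 : ℝ)).fun_neg
    change dX (fun p => -((1 / 4 : ℝ) • jet W 3 p)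
      - ((3 / 4 : ℝ) * inner ℝ (jet F 2 p) (jet W 2 p)) • jet F 1 p
      - ((3 / 8 : ℝ) * inner ℝ (jet F 2 p) (jet F 2 p)) • jet W 1 p) p = _
    rw [dX, dd_sub (g3.fun_sub (g1.fun_smul f1)) (g2.fun_smul w1), dd_sub g3 (g1.fun_smul f1),
      dd_neg (w3.fun_const_smul _), dd_const_smul w3, dd_smul g1 f1, dd_smul g2 w1,
      dd_const_mul (f2.inner ℝ w2), dd_const_mul (f2.inner ℝ f2), dd_inner f2 w2, dd_inner f2 f2]
    simp only [← jet_add_one]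
    rw [real_inner_comm (jet F 2 p) (jet F (2 + 1) p), two_mul]
  have key : ∀ t ∈ J, ∀ x, jet W 1 (s, t, x) = 0 := by
    intro t₁ ht₁ x
    obtain ⟨⟨C, hC⟩, ⟨C', hC'⟩, hB⟩ := hctrl t₁ ht₁
    -- The constant 9/4 = 3/2 + 3/4 adds up the two coefficients of the remainder, each term being
    -- at most |F_xx||F_xxx||W_x|².
    refine U.jet_one_eq_zero_of_balance hJ' hW hs h0 ht₀ (B := airyFlux F W)
      (r := fun p => (3 / 2 : ℝ) * (inner ℝ (jet W 1 p) (jet F 2 p) *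
          inner ℝ (jet W 1 p) (jet F 3 p))
        - (3 / 4 : ℝ) * (inner ℝ (jet F 2 p) (jet F 3 p) * inner ℝ (jet W 1 p) (jet W 1 p)))
      ?_ ?_ ht₁ ⟨9 / 4 * (C * C'), ?_⟩ hB x
    · exact (contDiffOn_const.mul (((cW 1).inner ℝ (U.jet_smooth 2)).mul
        ((cW 1).inner ℝ (U.jet_smooth 3)))).sub (contDiffOn_const.mul
        (((U.jet_smooth 2).inner ℝ (U.jet_smooth 3)).mul ((cW 1).inner ℝ (cW 1))))
    · intro t ht x
      have hp : (s, t, x) ∈ I ×ˢ J ×ˢ (univ : Set ℝ) := ⟨hs, ht, mem_univ x⟩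
      have w1 : HasDerivAt (fun y => jet W 1 (s, t, y)) (jet W 2 (s, t, x)) x :=
        hasDerivAt_dX (U.diffAt (cW 1) hp)
      have w2 : HasDerivAt (fun y => jet W 2 (s, t, y)) (jet W 3 (s, t, x)) x :=
        hasDerivAt_dX (U.diffAt (cW 2) hp)
      have w3 : HasDerivAt (fun y => jet W 3 (s, t, y)) (jet W 4 (s, t, x)) x :=
        hasDerivAt_dX (U.diffAt (cW 3) hp)
      have f2 : HasDerivAt (fun y => jet F 2 (s, t, y)) (jet F 3 (s, t, x)) x :=
        hasDerivAt_dX (U.diffAt_jet 2 hp)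
      have D := (((((w1.inner ℝ w3).const_mul (-(1 / 2 : ℝ))).fun_add
        ((w2.inner ℝ w2).const_mul (1 / 4 : ℝ))).fun_sub
        (((w1.inner ℝ f2).fun_mul (w1.inner ℝ f2)).const_mul (3 / 4 : ℝ))).fun_sub
        (((f2.inner ℝ f2).fun_mul (w1.inner ℝ w1)).const_mul (3 / 8 : ℝ)))
      refine D.congr_deriv ?_
      have hpp := hperp _ hp
      rw [hwt _ hp]
      simp only [inner_sub_right, inner_add_right, inner_neg_right, inner_smul_right]
      rw [real_inner_comm (jet F 1 (s, t, x)) (jet W 1 (s, t, x))] at *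
      rw [hpp]
      rw [real_inner_comm (jet F 3 (s, t, x)) (jet F 2 (s, t, x)),
        real_inner_comm (jet W 2 (s, t, x)) (jet W 1 (s, t, x)),
        real_inner_comm (jet W 2 (s, t, x)) (jet F 2 (s, t, x)),
        real_inner_comm (jet W 3 (s, t, x)) (jet W 2 (s, t, x))]
      ring
    · intro t ht x
      have b1 := hC t ht x
      have b2 := hC' t ht x
      have i1 := abs_real_inner_le_norm (jet W 1 (s, t, x)) (jet F 2 (s, t, x))
      have i2 := abs_real_inner_le_norm (jet W 1 (s, t, x)) (jet F 3 (s, t, x))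
      have i3 := abs_real_inner_le_norm (jet F 2 (s, t, x)) (jet F 3 (s, t, x))
      rw [real_inner_self_eq_norm_sq]
      have hCC : ‖jet F 2 (s, t, x)‖ * ‖jet F 3 (s, t, x)‖ ≤ C * C' :=
        mul_le_mul b1 b2 (norm_nonneg _) ((norm_nonneg _).trans b1)
      have j1 := mul_le_mul i1 i2 (abs_nonneg _) (by positivity)
      have j2 := mul_le_mul_of_nonneg_right i3 (sq_nonneg ‖jet W 1 (s, t, x)‖)
      have j3 := mul_le_mul_of_nonneg_right hCC (sq_nonneg ‖jet W 1 (s, t, x)‖)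
      refine (abs_sub _ _).trans ?_
      rw [abs_mul, abs_mul, abs_mul, abs_mul, abs_of_pos (by norm_num : (0 : ℝ) < 3 / 2),
        abs_of_pos (by norm_num : (0 : ℝ) < 3 / 4), abs_of_nonneg (sq_nonneg ‖jet W 1 (s, t, x)‖)]
      nlinarith
  refine fun t ht => U.eq_zero_of_jet_one hW hs ht₀ h0 key (fun t ht x e1 e2 e3 => ?_) hJ' ht
  rw [heq _ ⟨hs, ht, mem_univ x⟩, e1, e2, e3]
  simp

/-- The derivative of the flux produces the extra term ⟨W_x, H × W_xx⟩, apparently one derivative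
too many. But W_x and H are both normal, so W_x × H is parallel to e₀, and only ⟨e₀, W_xx⟩ = -⟨W_x,
H⟩ enters: the remainder is again quadratic in W_x. -/
theorem linearVfe_eq_zero
    (hperp : ∀ p ∈ I ×ˢ J ×ˢ (univ : Set ℝ), inner ℝ (jet F 1 p) (jet W 1 p) = (0 : ℝ))
    (heq : ∀ p ∈ I ×ˢ J ×ˢ (univ : Set ℝ), dT W p =
      (1 / 2 : ℝ) • (cross (jet W 1 p) (jet F 2 p) + cross (jet F 1 p) (jet W 2 p)))
    (hctrl : ∀ t₁ ∈ J, Controlled F (vfeFlux F W) s (uIcc t₀ t₁)) :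
    ∀ t ∈ J, ∀ x, W (s, t, x) = 0 := by
  have hΩ := U.isOpen
  have cW := contDiffOn_jet hΩ hW
  have hperp' : ∀ p ∈ I ×ˢ J ×ˢ (univ : Set ℝ), (inner ℝ (jet F 1 p) (jet W 2 p) : ℝ) =
      -inner ℝ (jet W 1 p) (jet F 2 p) := by
    intro p hp
    have h := dd_congr hΩ (G' := fun _ => (0 : ℝ)) hperp (0, 0, 1) p hp
    rw [dd_inner (U.diffAt_jet 1 hp) (U.diffAt (cW 1) hp)] at h
    change (inner ℝ (jet F 2 p) (jet W 1 p) + inner ℝ (jet F 1 p) (jet W 2 p) : ℝ) = _ at h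
    have h2 : dd (0, 0, 1) (fun _ : ℝ × ℝ × ℝ => (0 : ℝ)) p = 0 := by simp [dd]
    rw [real_inner_comm] at h
    linarith
  have hwt : ∀ p ∈ I ×ˢ J ×ˢ (univ : Set ℝ), dT (jet W 1) p =
      (1 / 2 : ℝ) • (cross (jet W 1 p) (jet F 3 p) + cross (jet F 1 p) (jet W 3 p)) := by
    intro p hp
    have f1 := U.diffAt_jet 1 hp
    have f2 := U.diffAt_jet 2 hp
    have w1 := U.diffAt (cW 1) hp
    have w2 := U.diffAt (cW 2) hp
    have c1 := U.diffAt ((cW 1).cross (U.jet_smooth 2)) hp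
    have c2 := U.diffAt ((U.jet_smooth 1).cross (cW 2)) hp
    rw [dT, dd_jet hΩ hW _ 1 p hp, jet_congr hΩ heq 1 p hp]
    change dX (fun p => (1 / 2 : ℝ) • (cross (jet W 1 p) (jet F 2 p)
      + cross (jet F 1 p) (jet W 2 p))) p = _
    rw [dX, dd_const_smul (c1.fun_add c2), dd_add c1 c2, dd_cross w1 f2, dd_cross f1 w2]
    change (1 / 2 : ℝ) • (cross (jet W 2 p) (jet F 2 p) + cross (jet W 1 p) (jet F 3 p)
      + (cross (jet F 2 p) (jet W 2 p) + cross (jet F 1 p) (jet W 3 p))) = _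
    -- The products W_xx × H and H × W_xx cancel by antisymmetry.
    apply ext_coord <;> simp <;> ring
  have key : ∀ t ∈ J, ∀ x, jet W 1 (s, t, x) = 0 := by
    intro t₁ ht₁ x
    obtain ⟨⟨C, hC⟩, -, hB⟩ := hctrl t₁ ht₁
    refine U.jet_one_eq_zero_of_balance hJ' hW hs h0 ht₀ (B := vfeFlux F W)
      (r := fun p => inner ℝ (jet F 1 p) (cross (jet W 1 p) (jet F 2 p)) *
        inner ℝ (jet W 1 p) (jet F 2 p)) ?_ ?_ ht₁ ⟨C * C, ?_⟩ hB x
    · exact ((U.jet_smooth 1).inner ℝ ((cW 1).cross (U.jet_smooth 2))).mul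
        ((cW 1).inner ℝ (U.jet_smooth 2))
    · intro t ht x
      have hp : (s, t, x) ∈ I ×ˢ J ×ˢ (univ : Set ℝ) := ⟨hs, ht, mem_univ x⟩
      have w1 : HasDerivAt (fun y => jet W 1 (s, t, y)) (jet W 2 (s, t, x)) x :=
        hasDerivAt_dX (U.diffAt (cW 1) hp)
      have w2 : HasDerivAt (fun y => jet W 2 (s, t, y)) (jet W 3 (s, t, x)) x :=
        hasDerivAt_dX (U.diffAt (cW 2) hp)
      have f1 : HasDerivAt (fun y => jet F 1 (s, t, y)) (jet F 2 (s, t, x)) x :=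
        hasDerivAt_dX (U.diffAt_jet 1 hp)
      refine (w1.inner ℝ (f1.cross w2)).congr_deriv ?_
      rw [hwt _ hp, inner_add_right, inner_smul_right, inner_add_right, inner_self_cross,
        inner_cross_self, inner_cross_of_unit (U.inner_one_one _ hp) (hperp _ hp)
          (U.inner_one_two _ hp), hperp' _ hp]
      ring
    · intro t ht x
      have hp : (s, t, x) ∈ I ×ˢ J ×ˢ (univ : Set ℝ) :=
        ⟨hs, hJ'.uIcc_subset ht₀ ht₁ ht, mem_univ x⟩
      have b1 := hC t ht x
      have i1 := abs_real_inner_le_norm (jet W 1 (s, t, x)) (jet F 2 (s, t, x))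
      have i2 := abs_real_inner_le_norm (jet F 1 (s, t, x))
        (cross (jet W 1 (s, t, x)) (jet F 2 (s, t, x)))
      have i3 := norm_cross_le (jet W 1 (s, t, x)) (jet F 2 (s, t, x))
      rw [U.norm_one _ hp, one_mul] at i2
      have hb : ‖jet W 1 (s, t, x)‖ * ‖jet F 2 (s, t, x)‖ ≤ ‖jet W 1 (s, t, x)‖ * C :=
        mul_le_mul_of_nonneg_left b1 (norm_nonneg _)
      rw [abs_mul]
      calc _ ≤ (‖jet W 1 (s, t, x)‖ * C) * (‖jet W 1 (s, t, x)‖ * C) :=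
            mul_le_mul (i2.trans (i3.trans hb)) (i1.trans hb) (abs_nonneg _)
              (le_trans (by positivity) hb)
        _ = _ := by ring
  refine fun t ht => U.eq_zero_of_jet_one hW hs ht₀ h0 key (fun t ht x e1 e2 _ => ?_) hJ' ht
  rw [heq _ ⟨hs, ht, mem_univ x⟩, e1, e2]
  apply ext_coord <;> simp

end linear

end UnitFamily

theorem jet_add_two {E : Type*} [NormedAddCommGroup E] [NormedSpace ℝ E] (f : ℝ × ℝ × ℝ → E) :
    ∀ n, jet f (n + 2) = jet (jet f 2) n
  | 0 => rfl
  | n + 1 => congrArg dX (jet_add_two f n)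

namespace UnitFamily

variable {I J : Set ℝ} {F : ℝ × ℝ × ℝ → E3} (U : UnitFamily I J F)
include U

omit U in
theorem slice_continuousOn {s : ℝ} (hs : s ∈ I) {K : Set ℝ} (hKJ : K ⊆ J) {f : ℝ × ℝ × ℝ → E3}
    (hf : ContDiffOn ℝ ∞ f (I ×ˢ J ×ˢ univ)) :
    ContinuousOn (fun p : ℝ × ℝ => f (s, p.1, p.2)) (K ×ˢ univ) :=
  hf.continuousOn.comp (by fun_prop) (fun _ hp => ⟨hs, hKJ hp.1, mem_univ _⟩)

/-! ### Closed curves -/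

section periodic

variable {L : ℝ} (hL : 0 < L) (hF : ∀ s ∈ I, ∀ t ∈ J, ∀ x, F (s, t, x + L) = F (s, t, x))
include hF

theorem airyField_periodic :
    ∀ s ∈ I, ∀ t ∈ J, ∀ x, airyField F (s, t, x + L) = airyField F (s, t, x) := by
  intro s hs t ht x
  simp only [airyField, jet_periodic U.openI U.openJ hF _ s hs t ht x]

theorem vfeField_periodic :
    ∀ s ∈ I, ∀ t ∈ J, ∀ x, vfeField F (s, t, x + L) = vfeField F (s, t, x) := by
  intro s hs t ht x
  simp only [vfeField, jet_periodic U.openI U.openJ hF _ s hs t ht x]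

include hL

theorem controlled_of_periodic {s : ℝ} (hs : s ∈ I) {K : Set ℝ} (hK : IsCompact K) (hKJ : K ⊆ J)
    {B : ℝ × ℝ × ℝ → ℝ} (hB : ∀ t ∈ J, ∀ x, B (s, t, x + L) = B (s, t, x)) :
    Controlled F B s K := by
  have hj := jet_periodic U.openI U.openJ hF
  exact ⟨bounded_of_periodic hK (slice_continuousOn hs hKJ (U.jet_smooth 2)) hL
      (fun t ht x => hj 2 s hs t (hKJ ht) x),
    bounded_of_periodic hK (slice_continuousOn hs hKJ (U.jet_smooth 3)) hL
      (fun t ht x => hj 3 s hs t (hKJ ht) x),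
    SmallIncrements.of_periodic hL (fun t ht x => hB t (hKJ ht) x)⟩

theorem controlled_airyFlux_of_periodic {W : ℝ × ℝ × ℝ → E3}
    (hW : ∀ s ∈ I, ∀ t ∈ J, ∀ x, W (s, t, x + L) = W (s, t, x))
    {s : ℝ} (hs : s ∈ I) {K : Set ℝ} (hK : IsCompact K) (hKJ : K ⊆ J) :
    Controlled F (airyFlux F W) s K :=
  U.controlled_of_periodic hL hF hs hK hKJ fun t ht x => by
    simp only [airyFlux, jet_periodic U.openI U.openJ hF _ s hs t ht x,
      jet_periodic U.openI U.openJ hW _ s hs t ht x]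

theorem controlled_vfeFlux_of_periodic {W : ℝ × ℝ × ℝ → E3}
    (hW : ∀ s ∈ I, ∀ t ∈ J, ∀ x, W (s, t, x + L) = W (s, t, x))
    {s : ℝ} (hs : s ∈ I) {K : Set ℝ} (hK : IsCompact K) (hKJ : K ⊆ J) :
    Controlled F (vfeFlux F W) s K :=
  U.controlled_of_periodic hL hF hs hK hKJ fun t ht x => by
    simp only [vfeFlux, jet_periodic U.openI U.openJ hF _ s hs t ht x,
      jet_periodic U.openI U.openJ hW _ s hs t ht x]

end periodic

/-! ### Curves with rapidly decaying curvature -/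

/-- At unit speed F_xx is the curvature vector on an open set, so all their derivatives agree there.
-/
theorem rapidDecay_jet_two (hF : RapidlyDecayingFamily I J (fun s t x => F (s, t, x))) :
    RapidDecay I J (jet F 2) := by
  refine ⟨U.jet_smooth 2, fun n N K hK hKs => ?_⟩
  obtain ⟨C, hC⟩ := hF n N K hK hKs
  refine ⟨C, fun p hp x => ?_⟩
  have he : jet F 2 =ᶠ[𝓝 (p.1, p.2, x)]
      fun z => meanCurvature (fun y => F (z.1, z.2.1, y)) z.2.2 := by
    filter_upwards [U.isOpen.mem_nhds ⟨(hKs hp).1, (hKs hp).2, mem_univ x⟩] with z hz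
    exact (congrFun (U.meanCurvature_eq hz.1 hz.2.1) z.2.2).symm
  rw [(he.iteratedFDeriv ℝ n).eq_of_nhds]
  exact hC p hp x

section decay

variable (hF : RapidlyDecayingFamily I J (fun s t x => F (s, t, x)))
  {s : ℝ} (hs : s ∈ I) {K : Set ℝ} (hK : IsCompact K) (hKJ : K ⊆ J)
include hF hs hK hKJ

theorem decays_jet (n : ℕ) : Decays K (fun p : ℝ × ℝ => jet F (n + 2) (s, p.1, p.2)) := by
  rw [jet_add_two]
  exact ((U.rapidDecay_jet_two hF).jet U.openI U.openJ n).decays hs hK hKJ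

theorem decays_jet_dS (n : ℕ) :
    Decays K (fun p : ℝ × ℝ => jet (dS F) (n + 2) (s, p.1, p.2)) := by
  refine ((((U.rapidDecay_jet_two hF).jet U.openI U.openJ n).dd U.openI U.openJ
    (1, 0, 0)).decays hs hK hKJ).congr fun t ht x => ?_
  rw [← jet_add_two]
  exact (dd_jet U.isOpen U.smooth _ _ _ ⟨hs, hKJ ht, mem_univ x⟩).symm

omit hF hK in
theorem tempered_jet_one : Tempered K (fun p : ℝ × ℝ => jet F 1 (s, p.1, p.2)) :=
  .of_bounded fun t ht x => (U.norm_one (s, t, x) ⟨hs, hKJ ht, mem_univ x⟩).le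

/-- Decay is assumed for the curvature only, not for variations of the tangent. Since F_sxx is
bounded, F_sx grows at most linearly, which is enough for the fluxes. -/
theorem tempered_jet_dS_one : Tempered K (fun p : ℝ × ℝ => jet (dS F) 1 (s, p.1, p.2)) := by
  have hc := contDiffOn_jet U.isOpen (contDiffOn_dd U.isOpen U.smooth (1, 0, 0)) 1
  exact Tempered.of_deriv hK (slice_continuousOn hs hKJ hc)
    (fun t ht x => hasDerivAt_dX (U.diffAt hc ⟨hs, hKJ ht, mem_univ x⟩))
    (U.decays_jet_dS hF hs hK hKJ 0)

theorem controlled_of_decays {B : ℝ × ℝ × ℝ → ℝ}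
    (hB : Decays K (fun p : ℝ × ℝ => B (s, p.1, p.2))) : Controlled F B s K :=
  ⟨(U.decays_jet hF hs hK hKJ 0).bounded, (U.decays_jet hF hs hK hKJ 1).bounded,
    hB.smallIncrements⟩

/-- W_x is merely tempered, but H, W_xx and W_xxx decay, and each term of the flux contains one of
them. -/
theorem controlled_airyFlux_of_decay :
    Controlled F (airyFlux F (fun q => dS F q - vfeField F q)) s K := by
  have hΩ := U.isOpen
  have hS := contDiffOn_dd hΩ U.smooth (1, 0, 0)
  have T := U.tempered_jet_one hs hKJ
  have D := U.decays_jet hF hs hK hKJ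
  have DS := U.decays_jet_dS hF hs hK hKJ
  have w1 : Tempered K (fun p : ℝ × ℝ =>
      jet (fun q => dS F q - vfeField F q) 1 (s, p.1, p.2)) := by
    refine ((U.tempered_jet_dS_one hF hs hK hKJ).add
      ((Decays.cross_right T (D 1)).const_smul (1 / 2)).neg.tempered).congr fun t ht x => ?_
    rw [jet_sub hΩ hS U.vfeField_smooth _ _ ⟨hs, hKJ ht, mem_univ x⟩,
      U.jet_vfeField_one _ ⟨hs, hKJ ht, mem_univ x⟩, sub_eq_add_neg]
  have w2 : Decays K (fun p : ℝ × ℝ => jet (fun q => dS F q - vfeField F q) 2 (s, p.1, p.2)) := by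
    refine ((DS 0).sub ((((D 0).cross_left (D 1).tempered).add
      (Decays.cross_right T (D 2))).const_smul (1 / 2))).congr fun t ht x => ?_
    rw [jet_sub hΩ hS U.vfeField_smooth _ _ ⟨hs, hKJ ht, mem_univ x⟩,
      U.jet_vfeField_two _ ⟨hs, hKJ ht, mem_univ x⟩]
  have w3 : Decays K (fun p : ℝ × ℝ => jet (fun q => dS F q - vfeField F q) 3 (s, p.1, p.2)) := by
    refine ((DS 1).sub (((((D 0).cross_left (D 2).tempered).const_smul 2).add
      (Decays.cross_right T (D 3))).const_smul (1 / 2))).congr fun t ht x => ?_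
    rw [jet_sub hΩ hS U.vfeField_smooth _ _ ⟨hs, hKJ ht, mem_univ x⟩,
      U.jet_vfeField_three _ ⟨hs, hKJ ht, mem_univ x⟩]
  have i1 := Decays.inner_right w1 (D 0)
  exact U.controlled_of_decays hF hs hK hKJ
    (((((Decays.inner_right w1 w3).const_smul (-(1 / 2))).add
    ((w2.inner_left w2.tempered).const_smul (1 / 4))).sub
    ((i1.smul i1.tempered).const_smul (3 / 4))).sub
    ((((D 0).inner_left (D 0).tempered).smul (w1.inner_tempered w1)).const_smul (3 / 8)))

/-- The flux is linear in the decaying W_xx; its other factors, W_x and e₀, are tempered. -/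
theorem controlled_vfeFlux_of_decay :
    Controlled F (vfeFlux F (fun q => dS F q - airyField F q)) s K := by
  have hΩ := U.isOpen
  have hS := contDiffOn_dd hΩ U.smooth (1, 0, 0)
  have T := U.tempered_jet_one hs hKJ
  have D := U.decays_jet hF hs hK hKJ
  have DS := U.decays_jet_dS hF hs hK hKJ
  have i22 := (D 0).inner_left (D 0).tempered
  have i23 := (D 0).inner_left (D 1).tempered
  have w1 : Tempered K (fun p : ℝ × ℝ =>
      jet (fun q => dS F q - airyField F q) 1 (s, p.1, p.2)) := by
    refine ((U.tempered_jet_dS_one hF hs hK hKJ).add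
      (((((D 2).const_smul (1 / 4)).neg.sub ((i23.const_smul (3 / 4)).smul T)).sub
      ((i22.const_smul (3 / 8)).smul (D 0).tempered)).neg.tempered)).congr fun t ht x => ?_
    rw [jet_sub hΩ hS U.airyField_smooth _ _ ⟨hs, hKJ ht, mem_univ x⟩,
      U.jet_airyField_one _ ⟨hs, hKJ ht, mem_univ x⟩, sub_eq_add_neg]
    rfl
  have w2 : Decays K (fun p : ℝ × ℝ => jet (fun q => dS F q - airyField F q) 2 (s, p.1, p.2)) := by
    refine ((DS 0).sub ((((((D 3).const_smul (1 / 4)).neg.sub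
      (((((D 1).inner_left (D 1).tempered).add
        ((D 0).inner_left (D 2).tempered)).const_smul (3 / 4)).smul T)).sub
      ((i23.const_smul (3 / 2)).smul (D 0).tempered))).sub
      ((i22.const_smul (3 / 8)).smul (D 1).tempered))).congr fun t ht x => ?_
    rw [jet_sub hΩ hS U.airyField_smooth _ _ ⟨hs, hKJ ht, mem_univ x⟩,
      U.jet_airyField_two _ ⟨hs, hKJ ht, mem_univ x⟩]
    rfl
  exact U.controlled_of_decays hF hs hK hKJ (Decays.inner_right w1 (Decays.cross_right T w2))

end decay

end UnitFamily

/-! ### The flows commute -/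

section commute

variable {X Y : (ℝ → E3) → ℝ → E3} {I J : Set ℝ} {s₀ t₀ : ℝ} {F : ℝ → ℝ → ℝ → E3}

/-- Unit speed spreads from F(s₀, t₀, ·) along the Y-flow in s at time `t₀`, and from there along
the X-flow in t. -/
theorem unitFamily_of_solutions
    (hX : ∀ c : ℝ → E3, ContDiff ℝ ∞ c → (∀ x, deriv c x ≠ 0) →
      ∀ x, inner ℝ (unitTangent c x) (deriv (X c) x) = (0 : ℝ))
    (hY : ∀ c : ℝ → E3, ContDiff ℝ ∞ c → (∀ x, deriv c x ≠ 0) →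
      ∀ x, inner ℝ (unitTangent c x) (deriv (Y c) x) = (0 : ℝ))
    (hI : IsOpen I) (hI' : I.OrdConnected) (hJ : IsOpen J) (hJ' : J.OrdConnected)
    (hs₀ : s₀ ∈ I) (ht₀ : t₀ ∈ J)
    (hF : ContDiffOn ℝ ∞ (fun z : ℝ × ℝ × ℝ => F z.1 z.2.1 z.2.2) (I ×ˢ J ×ˢ univ))
    (hunit : ∀ x, ‖deriv (F s₀ t₀) x‖ = 1) (hsY : IsSolution Y I (fun s => F s t₀))
    (hsX : ∀ s ∈ I, IsSolution X J (F s)) :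
    UnitFamily I J (fun z => F z.1 z.2.1 z.2.2) where
  openI := hI
  openJ := hJ
  smooth := hF
  unit s hs t ht x := by
    change ‖deriv (F s t) x‖ = 1
    rw [(hsX s hs).norm_deriv_eq hX hJ hJ' t ht t₀ ht₀ x,
      hsY.norm_deriv_eq hY hI hI' s hs s₀ hs₀ x, hunit x]

/-- If `F_s` equals the field `Z`, which represents `Y`, then `s ↦ F(s, t, ·)` solves the
`Y`-flow. -/
theorem UnitFamily.isSolution (U : UnitFamily I J (fun z => F z.1 z.2.1 z.2.2))
    {Z : ℝ × ℝ × ℝ → E3} (hZ : ∀ s ∈ I, ∀ t ∈ J, Y (F s t) = fun y => Z (s, t, y)) {t : ℝ}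
    (ht : t ∈ J) (h : ∀ s ∈ I, ∀ x, dS (fun z : ℝ × ℝ × ℝ => F z.1 z.2.1 z.2.2) (s, t, x)
      - Z (s, t, x) = 0) : IsSolution Y I (fun s => F s t) where
  smooth := U.smooth.comp (f := fun z : ℝ × ℝ => (z.1, t, z.2)) (by fun_prop)
    (fun z hz => ⟨hz.1, ht, mem_univ _⟩)
  immersed s hs x := U.slice_immersed hs ht x
  eqn s hs x := by
    rw [hZ s hs t ht]
    beta_reduce
    rw [← sub_eq_zero.1 (h s hs x)]
    exact hasDerivAt_dS (f := fun z : ℝ × ℝ × ℝ => F z.1 z.2.1 z.2.2)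
      (U.diffAt U.smooth ⟨hs, ht, mem_univ x⟩)

theorem carriesSolutions_normalizedAiry_vfe : CarriesSolutions normalizedAiry vfe := by
  intro I J s₀ t₀ F hI hI' hJ hJ' hs₀ ht₀ hF hfam hunit hsY hsX t ht
  have U := unitFamily_of_solutions (fun c => inner_tangent_deriv_normalizedAiry)
    (fun c => inner_tangent_deriv_vfe) hI hI' hJ hJ' hs₀ ht₀ hF hunit hsY hsX
  set G : ℝ × ℝ × ℝ → E3 := fun z => F z.1 z.2.1 z.2.2 with hG
  have hA : ∀ p ∈ I ×ˢ J ×ˢ (univ : Set ℝ), dT G p = airyField G p := by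
    rintro ⟨s, t, x⟩ ⟨hs, ht, -⟩
    rw [← congrFun (U.normalizedAiry_slice hs ht) x]
    exact (hasDerivAt_dT (U.diffAt U.smooth ⟨hs, ht, mem_univ x⟩)).unique
      ((hsX s hs).eqn t ht x)
  refine U.isSolution (fun s hs t ht => U.vfe_slice hs ht) ht fun s hs x => ?_
  -- Uniqueness is applied to W = F_s - Y(F) for each fixed s; W vanishes at `t₀` because F(·, t₀)
  -- solves the vortex filament equation.
  refine U.linearAiry_eq_zero hJ' ((contDiffOn_dd U.isOpen U.smooth _).sub U.vfeField_smooth) hs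
    ht₀ (fun x => ?_) U.inner_one_sub_vfeField (U.dT_sub_vfeField hA) (fun t₁ ht₁ => ?_) t ht x
  · rw [sub_eq_zero, ← congrFun (U.vfe_slice hs ht₀) x]
    exact (hasDerivAt_dS (U.diffAt U.smooth ⟨hs, ht₀, mem_univ x⟩)).unique (hsY.eqn s hs x)
  · have hKJ := hJ'.uIcc_subset ht₀ ht₁
    rcases hfam with ⟨L, hL, hper⟩ | hdec
    · refine U.controlled_airyFlux_of_periodic hL hper (fun s hs t ht x => ?_) hs
        isCompact_uIcc hKJ
      exact congrArg₂ (· - ·) (dd_periodic hI hJ hper _ s hs t ht x)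
        (U.vfeField_periodic hper s hs t ht x)
    · exact U.controlled_airyFlux_of_decay hdec hs isCompact_uIcc hKJ

theorem carriesSolutions_vfe_normalizedAiry : CarriesSolutions vfe normalizedAiry := by
  intro I J s₀ t₀ F hI hI' hJ hJ' hs₀ ht₀ hF hfam hunit hsY hsX t ht
  have U := unitFamily_of_solutions (fun c => inner_tangent_deriv_vfe)
    (fun c => inner_tangent_deriv_normalizedAiry) hI hI' hJ hJ' hs₀ ht₀ hF hunit hsY hsX
  set G : ℝ × ℝ × ℝ → E3 := fun z => F z.1 z.2.1 z.2.2 with hG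
  have hV : ∀ p ∈ I ×ˢ J ×ˢ (univ : Set ℝ), dT G p = vfeField G p := by
    rintro ⟨s, t, x⟩ ⟨hs, ht, -⟩
    rw [← congrFun (U.vfe_slice hs ht) x]
    exact (hasDerivAt_dT (U.diffAt U.smooth ⟨hs, ht, mem_univ x⟩)).unique
      ((hsX s hs).eqn t ht x)
  refine U.isSolution (fun s hs t ht => U.normalizedAiry_slice hs ht) ht fun s hs x => ?_
  refine U.linearVfe_eq_zero hJ' ((contDiffOn_dd U.isOpen U.smooth _).sub U.airyField_smooth) hs
    ht₀ (fun x => ?_) U.inner_one_sub_airyField (U.dT_sub_airyField hV) (fun t₁ ht₁ => ?_) t ht x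
  · rw [sub_eq_zero, ← congrFun (U.normalizedAiry_slice hs ht₀) x]
    exact (hasDerivAt_dS (U.diffAt U.smooth ⟨hs, ht₀, mem_univ x⟩)).unique (hsY.eqn s hs x)
  · have hKJ := hJ'.uIcc_subset ht₀ ht₁
    rcases hfam with ⟨L, hL, hper⟩ | hdec
    · refine U.controlled_vfeFlux_of_periodic hL hper (fun s hs t ht x => ?_) hs
        isCompact_uIcc hKJ
      exact congrArg₂ (· - ·) (dd_periodic hI hJ hper _ s hs t ht x)
        (U.airyField_periodic hper s hs t ht x)
    · exact U.controlled_vfeFlux_of_decay hdec hs isCompact_uIcc hKJ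

end commute

end CurveFlow

end

theorem theorem7p4 :
    -- the geometric Airy flow preserves the total arc-length of closed curves
    (∀ (J : Set ℝ) (γ : ℝ → ℝ → CurveFlow.E3) (L : ℝ),
      IsOpen J → J.OrdConnected → CurveFlow.IsSolution CurveFlow.airy J γ →
      0 < L → (∀ t ∈ J, ∀ x, γ t (x + L) = γ t x) →
      ∀ t₁ ∈ J, ∀ t₂ ∈ J,
        CurveFlow.arcLength (γ t₁) 0 L = CurveFlow.arcLength (γ t₂) 0 L) ∧
    -- the same for curves on the line whose curvature tends to zero at both ends
    (∀ (J : Set ℝ) (γ : ℝ → ℝ → CurveFlow.E3),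
      IsOpen J → J.OrdConnected → CurveFlow.IsSolution CurveFlow.airy J γ →
      (∀ K : Set ℝ, IsCompact K → K ⊆ J →
        TendstoUniformlyOn (fun (x t : ℝ) => CurveFlow.meanCurvature (γ t) x) (fun _ => 0)
          (cocompact ℝ) K) →
      ∀ t₁ ∈ J, ∀ t₂ ∈ J,
        CurveFlow.totalArcLength (γ t₁) = CurveFlow.totalArcLength (γ t₂) ∧
        Tendsto (fun p : ℝ × ℝ =>
            CurveFlow.arcLength (γ t₁) p.1 p.2 - CurveFlow.arcLength (γ t₂) p.1 p.2)
          (atBot ×ˢ atTop) (𝓝 0)) ∧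
    -- the normalized geometric Airy flow preserves the arc-length parameter
    (∀ (J : Set ℝ) (γ : ℝ → ℝ → CurveFlow.E3),
      IsOpen J → J.OrdConnected → CurveFlow.IsSolution CurveFlow.normalizedAiry J γ →
      ∀ t₁ ∈ J, ∀ t₂ ∈ J, ∀ x, ‖deriv (γ t₁) x‖ = ‖deriv (γ t₂) x‖) ∧
    -- the normalized geometric Airy field and the vortex filament field commute
    (∀ γ : ℝ → CurveFlow.E3, ContDiff ℝ ∞ γ → (∀ x, deriv γ x ≠ 0) →
      CurveFlow.BracketVanishesAt CurveFlow.normalizedAiry CurveFlow.vfe γ) ∧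
    -- the two flows commute
    CurveFlow.CarriesSolutions CurveFlow.normalizedAiry CurveFlow.vfe ∧
    CurveFlow.CarriesSolutions CurveFlow.vfe CurveFlow.normalizedAiry := by
  exact ⟨fun _ _ _ hJ hJ' h _ hL => CurveFlow.airy_arcLength_periodic hJ hJ' h hL,
    fun _ _ hJ hJ' h hH _ h₁ _ h₂ => ⟨CurveFlow.airy_totalArcLength_eq hJ hJ' h hH h₁ h₂,
      CurveFlow.airy_arcLength_sub_tendsto hJ hJ' h hH h₁ h₂⟩,
    fun _ _ hJ hJ' h => h.norm_deriv_eq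
      (fun _ => CurveFlow.inner_tangent_deriv_normalizedAiry) hJ hJ',
    fun _ => CurveFlow.bracketVanishesAt, CurveFlow.carriesSolutions_normalizedAiry_vfe,
    CurveFlow.carriesSolutions_vfe_normalizedAiry⟩
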